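/- Let $n\ge 2$ and $\nu\ge 0$ be integers, and let $p_\nu\in\mathbb{C}[x_1,\dots,x_n]$ be a harmonic homogeneous polynomial of degree $\nu$ (that is, $\sum_{j}\partial^2 p_\nu/\partial x_j^2=0$). Write $e(w)=e^{2\pi i w}$ and, for $z$ in the upper half plane $\mathbb{H}$, $$\theta(z)=\sum_{x\in\mathbb{Z}^n}p_\nu(x)\,e(|x|^2z),\qquad |x|^2=x_1^2+\dots+x_n^2 .$$ For $\gamma=\begin{pmatrix}a&b\\c&d\end{pmatrix}\in\Gamma_0(4)=\{\gamma\in SL_2(\mathbb{Z}):4\mid c\}$ let $$j(\gamma,z)=\left(\frac cd\right)\varepsilon_d^{-1}(cz+d)^{1/2},$$ where $\varepsilon_d=1$ if $d\equiv1 \pmod 4$ and $\varepsilon_d=i$ if $d\equiv3\pmod 4$, the square root is the principal one (with $\sqrt{-1}=i$), and $\left(\frac cd\right)$ is the quadratic residue symbol in Shimura's extension: the Jacobi symbol $\left(\frac c{|d|}\right)$, multiplied by $-1$ if both $c<0$ and $d<0$ (so that $\left(\frac 0{\pm1}\right)=1$). Then the series converges absolutely for every $z\in\mathbb{H}$, $\theta$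 is holomorphic on $\mathbb{H}$, and $$\theta(\gamma z)=j(\gamma,z)^{2\nu+n}\,\theta(z)\qquad\text{for all }\gamma\in\Gamma_0(4),\ z\in\mathbb{H}.$$ If moreover $\nu>0$, then $\theta$ is a cusp form of weight $\nu+n/2$ on $\Gamma_0(4)$: in addition to the above it vanishes at every cusp, i.e. for every $\begin{pmatrix}a&b\\c&d\end{pmatrix}\in SL_2(\mathbb{Z})$, $$(cz+d)^{-(\nu+n/2)}\,\theta\!\left(\frac{az+b}{cz+d}\right)\longrightarrow0\quad\text{as }\operatorname{Im}z\to\infty,$$ uniformly in $\operatorname{Re}z$. -/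

import Mathlib

open scoped UpperHalfPlane MatrixGroups Manifold NumberTheorySymbols

noncomputable section

namespace ThetaHarmonic

/-- The Laplacian `∑ ∂²/∂x_i²` on complex polynomials in `n` variables. -/
def laplacian {n : ℕ} (p : MvPolynomial (Fin n) ℂ) : MvPolynomial (Fin n) ℂ :=
  ∑ i, MvPolynomial.pderiv i (MvPolynomial.pderiv i p)

/-- A polynomial is harmonic if its Laplacian vanishes. -/
def IsHarmonic {n : ℕ} (p : MvPolynomial (Fin n) ℂ) : Prop :=
  laplacian p = 0

/-- `e(w) = exp(2πiw)`. -/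
def e (w : ℂ) : ℂ :=
  Complex.exp (2 * Real.pi * Complex.I * w)

/-- The term `p(x) e(|x|² z)` of the theta series, for `x ∈ ℤⁿ`. -/
def thetaTerm {n : ℕ} (p : MvPolynomial (Fin n) ℂ) (z : ℍ) (x : Fin n → ℤ) : ℂ :=
  MvPolynomial.eval (fun i => (x i : ℂ)) p * e ((∑ i, (x i : ℂ) ^ 2) * (z : ℂ))

/-- The theta series `θ(z) = ∑_{x ∈ ℤⁿ} p(x) e(|x|² z)`. -/
def theta {n : ℕ} (p : MvPolynomial (Fin n) ℂ) (z : ℍ) : ℂ :=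
  ∑' x : Fin n → ℤ, thetaTerm p z x

/-- Shimura's extension `(c/d)` of the quadratic residue symbol to odd integers `d` of either
sign: the Jacobi symbol `(c/|d|)`, with an additional sign exactly when `c` and `d` are both
negative. In particular the symbol is `1` for `c = 0`, `d = ±1`, and for
`d = -1`, `c ≠ 0` it is the sign of `c`. -/
def shimuraSymbol (c d : ℤ) : ℤ :=
  if c < 0 ∧ d < 0 then -J(c | d.natAbs) else J(c | d.natAbs)

/-- For odd `d`: `ε_d = 1` if `d ≡ 1 mod 4`, and `ε_d = i` if `d ≡ 3 mod 4`. -/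
def eps (d : ℤ) : ℂ :=
  if d % 4 = 1 then 1 else Complex.I

/-- The theta multiplier `j(γ, z) = (c/d) ε_d⁻¹ (cz+d)^{1/2}`, where `(c, d)` is the bottom row
of `γ` and the square root is the principal one (argument in `(-π/2, π/2]`). -/
def thetaMultiplier (γ : SL(2, ℤ)) (z : ℍ) : ℂ :=
  (shimuraSymbol (γ 1 0) (γ 1 1) : ℂ) * (eps (γ 1 1))⁻¹ *
    ((γ 1 0 : ℂ) * (z : ℂ) + (γ 1 1 : ℂ)) ^ (1 / 2 : ℂ)

/-- `f` is a cusp form of weight `k / 2` on `Γ₀(4)`, with respect to the theta multiplier: it is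
holomorphic on the upper half plane, it transforms by `j(γ, z)^k` under every `γ ∈ Γ₀(4)`, and it
vanishes at every cusp, that is, for every `g ∈ SL₂(ℤ)` with bottom row `(c, d)` the function
`(cz+d)^{-k/2} f(gz)` tends to `0` as `Im z → ∞`. -/
structure IsCuspFormGamma0Four (k : ℕ) (f : ℍ → ℂ) : Prop where
  holomorphic : MDifferentiable 𝓘(ℂ) 𝓘(ℂ) f
  transform : ∀ γ ∈ CongruenceSubgroup.Gamma0 4, ∀ z : ℍ,
    f (γ • z) = thetaMultiplier γ z ^ k * f z
  zero_at_cusps : ∀ g : SL(2, ℤ), UpperHalfPlane.IsZeroAtImInfty fun z : ℍ =>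
    ((g 1 0 : ℂ) * (z : ℂ) + (g 1 1 : ℂ)) ^ (-(k : ℂ) / 2) * f (g • z)

end ThetaHarmonic

end

namespace ThetaHarmonic

/-! ### The theta multiplier and generators of `Γ₀(4)`. -/

section

open Complex

/-! The transformation law is reduced to `z ↦ z + 1` and `z ↦ z / (4z + 1)`. A Euclidean descent on
the bottom row (`Gamma0_four_induction`) reaches all of `Γ₀(4)` from matrices with `c = 0`, and the
multiplier satisfies the cocycle relation along both generators. For the second one, the sign by
which principal square roots fail to be multiplicative is exactly the sign in Shimura's symbol.

Invariance under translation is immediate. The other generator is a translation by 2 conjugated by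
inversion in the variable `τ = 2z`, so it follows from the inversion formula `thetaSum_inversion`.
That formula is obtained without Fourier transforms of harmonic polynomials. For constant
coefficients it is a product of functional equations of `jacobiTheta₂` with a free elliptic variable
`w`. Differentiating in `w_i` inserts a factor `x_i` on one side and acts as `x_i + 2s∂_i` on the
other. Since `exp(sΔ) x_i = (x_i + 2s∂_i) exp(sΔ)`, a polynomial `p` on one side corresponds to
`exp(sΔ)p` on the other (`exists_thetaSum_eq_heat`). Harmonic polynomials are fixed by `exp(sΔ)`,
and homogeneity supplies the weight.

At the cusps only absolute values matter. Up to unimodular factors, `SL(2, ℤ)` permutes three theta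
series with characteristics 0 or 1/2 (`exists_normSlash`). Each decays exponentially when `ν > 0`: a
term `x = 0` without shift is killed by `p(0) = 0`, and a half-integral shift keeps all lattice
points away from the origin. -/

theorem jacobiSym_eq_of_add_eq {c : ℤ} (h4 : 4 ∣ c) {a b : ℕ} (ha : Odd a) (hb : Odd b)
    (h : (a : ℤ) + b = c) : J(c | a) = J(c | b) := by
  have h1 : J(c | a) = J(b | a) := jacobiSym.mod_left' (by rw [← h]; simp)
  have h2 : J(c | b) = J(a | b) := jacobiSym.mod_left' (by rw [← h]; simp)
  rw [h1, h2]
  have : a % 4 = 1 ∨ b % 4 = 1 := by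
    rw [Nat.odd_iff] at ha hb; omega
  rcases this with h | h
  · exact (jacobiSym.quadratic_reciprocity_one_mod_four h hb).symm
  · exact jacobiSym.quadratic_reciprocity_one_mod_four h ha

/-- The general period is `4|c|`. Writing `c = 4k`, the factor 4 is a square, so the symbol is that
of `k`, whose period is `4|k| = |c|`. -/
theorem jacobiSym_mod_right_of_four_dvd {c : ℤ} (h4 : 4 ∣ c) {b : ℕ} (hb : Odd b) :
    J(c | b) = J(c | b % c.natAbs) := by
  obtain ⟨k, rfl⟩ := h4
  have hb' : Odd (b % (4 * k).natAbs) := by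
    rw [Nat.odd_iff] at hb ⊢
    rw [Nat.mod_mod_of_dvd b (by rw [Int.natAbs_mul]; exact Dvd.dvd.mul_right (by decide) _), hb]
  rw [jacobiSym.mul_left, jacobiSym.mul_left, jacobiSym.at_four hb, jacobiSym.at_four hb',
    one_mul, one_mul, jacobiSym.mod_right k hb, Int.natAbs_mul]
  rfl

/-- Shimura's sign is what makes the symbol periodic in `d` modulo `c` across both signs of `d`; the
right-hand side visibly depends only on that residue. -/
theorem shimuraSymbol_eq_emod {c d : ℤ} (hc : c ≠ 0) (h4 : 4 ∣ c) (hd : Odd d) :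
    shimuraSymbol c d = J(c | (d % c).toNat) := by
  have hdn : Odd d.natAbs := Int.natAbs_odd.2 hd
  unfold shimuraSymbol
  rw [jacobiSym_mod_right_of_four_dvd h4 hdn]
  have hcpos : 0 < c.natAbs := Int.natAbs_pos.2 hc
  have hmc : d % c = d % (c.natAbs : ℤ) := by rw [Int.natCast_natAbs, Int.emod_abs]
  rw [hmc]
  set m := c.natAbs with hm
  have hm4 : 4 ∣ m := by omega
  have hodd : Odd (d.natAbs % m) := by
    rw [Nat.odd_iff] at hdn ⊢
    rw [Nat.mod_mod_of_dvd _ (dvd_trans (by decide) hm4), hdn]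
  rcases lt_or_ge d 0 with hneg | hpos
  · set r := d.natAbs % m with hr
    have hrm : r < m := Nat.mod_lt _ hcpos
    have hr0 : 0 < r := hodd.pos
    have hd' : d % (m : ℤ) = m - r := by
      have e1 : d = -(d.natAbs : ℤ) := by omega
      have e2 : (d.natAbs : ℤ) = m * (d.natAbs / m : ℕ) + r := by
        exact_mod_cast (Nat.div_add_mod d.natAbs m).symm
      have e3 : d = (m - r) + m * (-(d.natAbs / m : ℕ) - 1) := by
        rw [e1, e2]; ring_nf; simp; grind
      rw [e3, Int.add_mul_emod_self_left, Int.emod_eq_of_lt (by omega) (by omega)]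
    have e4 : (d % (m : ℤ)).toNat = m - r := by omega
    rw [e4]
    have hodd' : Odd (m - r) := by rw [Nat.odd_iff] at hodd ⊢; omega
    have key : J((m : ℤ) | r) = J((m : ℤ) | m - r) :=
      jacobiSym_eq_of_add_eq (by omega) hodd hodd' (by omega)
    rcases lt_or_gt_of_ne hc with hc' | hc'
    · rw [if_pos ⟨hc', hneg⟩]
      have : c = -(m : ℤ) := by omega
      rw [this, jacobiSym.neg _ hodd, jacobiSym.neg _ hodd', key]
      -- The two odd residues sum to a multiple of 4, so `(-1/·)` differs between them; this cancels
      -- the extra sign for `c, d < 0`.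
      have : ZMod.χ₄ ((m - r : ℕ) : ZMod 4) = - ZMod.χ₄ (r : ZMod 4) := by
        rw [Nat.odd_iff] at hodd
        rw [ZMod.χ₄_nat_eq_if_mod_four, ZMod.χ₄_nat_eq_if_mod_four]
        have : r % 4 = 1 ∨ r % 4 = 3 := by omega
        rcases this with h | h
        · have h' : (m - r) % 4 = 3 := by omega
          simp [h, h', show r % 2 = 1 by omega, show (m - r) % 2 = 1 by omega]
        · have h' : (m - r) % 4 = 1 := by omega
          simp [h, h', show r % 2 = 1 by omega, show (m - r) % 2 = 1 by omega]
      rw [this]; ring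
    · rw [if_neg (by omega)]
      have : c = (m : ℤ) := by omega
      rw [this, key]
  · rw [if_neg (by omega)]
    congr 1
    have : (d.natAbs : ℤ) % m = d % m := by rw [Int.natAbs_of_nonneg hpos]
    omega

theorem shimuraSymbol_add_right {c d : ℤ} (h4 : 4 ∣ c) (hd : Odd d) :
    shimuraSymbol c (d + c) = shimuraSymbol c d := by
  rcases eq_or_ne c 0 with rfl | hc
  · simp
  · have hc2 : Even c := (even_iff_two_dvd).2 (dvd_trans (by norm_num) h4)
    rw [shimuraSymbol_eq_emod hc h4 (hd.add_even hc2), shimuraSymbol_eq_emod hc h4 hd]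
    simp

theorem shimuraSymbol_add_left (c d : ℤ) :
    shimuraSymbol (c + 4 * d) d =
      if d < 0 ∧ 0 ≤ c ∧ c + 4 * d < 0 then -shimuraSymbol c d else shimuraSymbol c d := by
  have : J(c + 4 * d | d.natAbs) = J(c | d.natAbs) := jacobiSym.mod_left' <| by
    exact Int.emod_eq_emod_iff_emod_sub_eq_zero.2 (by simp)
  unfold shimuraSymbol
  rw [this]
  split_ifs <;> first | rfl | omega

theorem eps_add {c d : ℤ} (h4 : 4 ∣ c) : eps (d + c) = eps d := by
  unfold eps
  rw [show (d + c) % 4 = d % 4 by omega]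

/-! ### Multiplicativity of the principal square root. -/

theorem sq_cpow_half {u : ℂ} (h : 0 < u.re ∨ u.re = 0 ∧ 0 ≤ u.im) : (u ^ 2) ^ (1 / 2 : ℂ) = u := by
  have h1 : arg u ≤ Real.pi / 2 := by
    rw [arg_le_pi_div_two_iff]; rcases h with h | h
    · exact Or.inl h.le
    · exact Or.inl h.1.ge
  have h2 : -(Real.pi / 2) < arg u := by
    rw [neg_pi_div_two_lt_arg_iff]; tauto
  have := Complex.pow_cpow_nat_inv (x := u) (n := 2) (by norm_num) (by simpa [neg_div] using h2)
    (by simpa using h1)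
  simpa using this

theorem cpow_half_sq (u : ℂ) : (u ^ (1 / 2 : ℂ)) ^ 2 = u := by
  simp

theorem cpow_half_nonneg {u : ℂ} (hu : u ≠ 0) :
    0 < (u ^ (1 / 2 : ℂ)).re ∨ (u ^ (1 / 2 : ℂ)).re = 0 ∧ 0 < (u ^ (1 / 2 : ℂ)).im := by
  have h0 : u ^ (1 / 2 : ℂ) = exp (log u * (1 / 2)) := cpow_def_of_ne_zero hu _
  have him : (log u * (1 / 2)).im = arg u / 2 := by
    rw [show (1 / 2 : ℂ) = ((1 / 2 : ℝ) : ℂ) by norm_num, im_mul_ofReal, log_im]; ring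
  rw [h0, exp_re, exp_im, him]
  have h1 := neg_pi_lt_arg u
  rcases (arg_le_pi u).lt_or_eq with h2 | h2
  · exact Or.inl (mul_pos (Real.exp_pos _) (Real.cos_pos_of_mem_Ioo ⟨by linarith, by linarith⟩))
  · right
    rw [h2]
    simp [Real.exp_pos]

/-- Both roots lie in the first quadrant (the one of `u` possibly on its boundary), so their product
lies in the upper half plane. It is the principal root up to sign, and the sign is read off from the
imaginary part `(c + 4d) Im z` of its square. -/
theorem mul_cpow_half_of_nonneg {c d : ℤ} {u z : ℂ} (hz : 0 < z.im) (hu : u * (4 * z + 1) = ((c + 4 * d : ℤ) : ℂ) * z + d)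
    (hu0 : u ≠ 0) (huim : 0 ≤ u.im) :
    (((c + 4 * d : ℤ) : ℂ) * z + d) ^ (1 / 2 : ℂ) =
      (if c + 4 * d < 0 then -1 else 1) * (u ^ (1 / 2 : ℂ) * (4 * z + 1) ^ (1 / 2 : ℂ)) := by
  have hv0 : (4 * z + 1) ≠ 0 := fun h => by
    have := congrArg Complex.im h; simp at this; linarith
  set A := u ^ (1 / 2 : ℂ) with hA
  set B := (4 * z + 1) ^ (1 / 2 : ℂ) with hB
  have hA2 : A ^ 2 = u := cpow_half_sq u
  have hB2 : B ^ 2 = 4 * z + 1 := cpow_half_sq _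
  have hAn := cpow_half_nonneg hu0
  have hBn := cpow_half_nonneg hv0
  rw [← hA] at hAn
  rw [← hB] at hBn
  have hBim : 2 * B.re * B.im = 4 * z.im := by
    have := congrArg Complex.im hB2
    simp [pow_two] at this; linarith
  have hAim : 2 * A.re * A.im = u.im := by
    have := congrArg Complex.im hA2
    simp [pow_two] at this; linarith
  have hB1 : 0 < B.re := by
    rcases hBn with h | h
    · exact h
    · rw [h.1] at hBim; linarith
  have hBi : 0 < B.im := by
    by_contra hcon; push Not at hcon; nlinarith
  have hABim : 0 < (A * B).im := by
    rw [mul_im]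
    rcases hAn with h | h
    · have : 0 ≤ A.im := by by_contra hcon; push Not at hcon; nlinarith
      nlinarith [mul_pos h hBi, mul_nonneg this hB1.le]
    · rw [h.1]; nlinarith [mul_pos h.2 hB1]
  have hAB2 : (A * B) ^ 2 = ((c + 4 * d : ℤ) : ℂ) * z + d := by
    rw [mul_pow, hA2, hB2, hu]
  have him : 2 * (A * B).re * (A * B).im = ((c + 4 * d : ℤ) : ℝ) * z.im := by
    have := congrArg Complex.im hAB2
    rw [pow_two, mul_im (A * B), add_im, mul_im (_ : ℂ) z, intCast_im, intCast_re,
      intCast_im] at this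
    linarith
  rw [← hAB2]
  split_ifs with hneg
  · have hlt : ((c + 4 * d : ℤ) : ℝ) < 0 := by exact_mod_cast hneg
    have : (A * B).re < 0 := by
      by_contra hcon; push Not at hcon; nlinarith [mul_nonneg hcon hABim.le]
    rw [← neg_sq, sq_cpow_half (Or.inl (by simpa using this))]; ring
  · have hge : (0 : ℝ) ≤ ((c + 4 * d : ℤ) : ℝ) := by exact_mod_cast not_lt.1 hneg
    have : 0 ≤ (A * B).re := by
      by_contra hcon; push Not at hcon; nlinarith [mul_pos_of_neg_of_neg hcon (neg_neg_of_pos hABim)]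
    rw [one_mul]
    exact sq_cpow_half (this.lt_or_eq.imp id fun h => ⟨h.symm, hABim.le⟩)

/-- The arguments have opposite signs, so their sum does not cross the branch cut. -/
theorem mul_cpow_half_of_neg {u v : ℂ} (hv : 0 < v.im) (hu : u.im < 0) :
    (u * v) ^ (1 / 2 : ℂ) = u ^ (1 / 2 : ℂ) * v ^ (1 / 2 : ℂ) := by
  have hv0 : v ≠ 0 := fun h => by simp [h] at hv
  have hu0 : u ≠ 0 := fun h => by simp [h] at hu
  set A := u ^ (1 / 2 : ℂ) with hA
  set B := v ^ (1 / 2 : ℂ) with hB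
  have hA2 : A ^ 2 = u := cpow_half_sq u
  have hB2 : B ^ 2 = v := cpow_half_sq _
  have hAn := cpow_half_nonneg hu0
  have hBn := cpow_half_nonneg hv0
  rw [← hA] at hAn
  rw [← hB] at hBn
  have hBim : 2 * B.re * B.im = v.im := by
    have := congrArg Complex.im hB2
    simp [pow_two] at this; linarith
  have hAim : 2 * A.re * A.im = u.im := by
    have := congrArg Complex.im hA2
    simp [pow_two] at this; linarith
  have hB1 : 0 < B.re := by
    rcases hBn with h | h
    · exact h
    · rw [h.1] at hBim; linarith
  have hA1 : 0 < A.re := by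
    rcases hAn with h | h
    · exact h
    · rw [h.1] at hAim; linarith
  have hBi : 0 < B.im := by
    by_contra hcon; push Not at hcon; nlinarith
  have hAi : A.im < 0 := by
    by_contra hcon; push Not at hcon; nlinarith
  have hre : 0 < (A * B).re := by
    rw [mul_re]; nlinarith [mul_pos hA1 hB1, mul_neg_of_neg_of_pos hAi hBi]
  rw [← hA2, ← hB2, ← mul_pow]
  exact sq_cpow_half (Or.inl hre)

/-- The matrix `(1 0; 4 1)`. -/
def lowerFour : SL(2, ℤ) := ⟨!![1, 0; 4, 1], by simp⟩

theorem four_dvd_of_mem_Gamma0 {γ : SL(2, ℤ)} (h : γ ∈ CongruenceSubgroup.Gamma0 4) :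
    4 ∣ γ 1 0 := by
  rw [CongruenceSubgroup.Gamma0_mem] at h
  exact_mod_cast (ZMod.intCast_zmod_eq_zero_iff_dvd _ 4).1 h

theorem det_eq_one (γ : SL(2, ℤ)) : γ 0 0 * γ 1 1 - γ 0 1 * γ 1 0 = 1 := by
  have := γ.det_coe
  rwa [Matrix.det_fin_two] at this

theorem odd_of_four_dvd {γ : SL(2, ℤ)} (h : 4 ∣ γ 1 0) : Odd (γ 1 1) := by
  have h1 := det_eq_one γ
  obtain ⟨k, hk⟩ := h
  rw [hk] at h1
  by_contra hc
  rw [Int.not_odd_iff_even] at hc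
  obtain ⟨m, hm⟩ := hc
  rw [hm] at h1
  have : 2 * (γ 0 0 * m - 2 * (γ 0 1 * k)) = 1 := by linarith
  omega

theorem T_mem_Gamma0 (N : ℕ) : ModularGroup.T ∈ CongruenceSubgroup.Gamma0 N := by
  rw [CongruenceSubgroup.Gamma0_mem, ModularGroup.coe_T]
  simp

theorem lowerFour_mem_Gamma0 : lowerFour ∈ CongruenceSubgroup.Gamma0 4 := by
  rw [CongruenceSubgroup.Gamma0_mem]
  simp [lowerFour]; rfl

theorem coe_lowerFour : (lowerFour : Matrix (Fin 2) (Fin 2) ℤ) = !![1, 0; 4, 1] := rfl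

theorem coe_lowerFour_inv :
    ((lowerFour⁻¹ : SL(2, ℤ)) : Matrix (Fin 2) (Fin 2) ℤ) = !![1, 0; -4, 1] := by
  simp [Matrix.SpecialLinearGroup.coe_inv, coe_lowerFour, Matrix.adjugate_fin_two]

theorem mul_T_row (γ : SL(2, ℤ)) : (γ * ModularGroup.T) 1 0 = γ 1 0 ∧
    (γ * ModularGroup.T) 1 1 = γ 1 1 + γ 1 0 := by
  rw [Matrix.SpecialLinearGroup.coe_mul, ModularGroup.coe_T]
  constructor
  · simp [Matrix.mul_apply, Fin.sum_univ_two]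
  · simp [Matrix.mul_apply, Fin.sum_univ_two, add_comm]

theorem mul_T_inv_row (γ : SL(2, ℤ)) : (γ * ModularGroup.T⁻¹) 1 0 = γ 1 0 ∧
    (γ * ModularGroup.T⁻¹) 1 1 = γ 1 1 - γ 1 0 := by
  rw [Matrix.SpecialLinearGroup.coe_mul, ModularGroup.coe_T_inv]
  constructor
  · simp [Matrix.mul_apply, Fin.sum_univ_two]
  · simp [Matrix.mul_apply, Fin.sum_univ_two]; ring

theorem mul_lowerFour_row (γ : SL(2, ℤ)) : (γ * lowerFour) 1 0 = γ 1 0 + 4 * γ 1 1 ∧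
    (γ * lowerFour) 1 1 = γ 1 1 := by
  rw [Matrix.SpecialLinearGroup.coe_mul, coe_lowerFour]
  constructor
  · simp [Matrix.mul_apply, Fin.sum_univ_two]; ring
  · simp [Matrix.mul_apply, Fin.sum_univ_two]

theorem mul_lowerFour_inv_row (γ : SL(2, ℤ)) : (γ * lowerFour⁻¹) 1 0 = γ 1 0 - 4 * γ 1 1 ∧
    (γ * lowerFour⁻¹) 1 1 = γ 1 1 := by
  rw [Matrix.SpecialLinearGroup.coe_mul, coe_lowerFour_inv]
  constructor
  · simp [Matrix.mul_apply, Fin.sum_univ_two]; ring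
  · simp [Matrix.mul_apply, Fin.sum_univ_two]

theorem coe_lowerFour_smul (z : ℍ) : ((lowerFour • z : ℍ) : ℂ) = z / (4 * z + 1) := by
  rw [UpperHalfPlane.specialLinearGroup_apply]
  simp [lowerFour]

theorem coe_T_smul (z : ℍ) : ((ModularGroup.T • z : ℍ) : ℂ) = z + 1 := by
  rw [UpperHalfPlane.specialLinearGroup_apply]
  simp [ModularGroup.T]

/-- Descent on `|c| + |d|`: replace `d` by `d ± c` if `|c| < 2|d|`, and `c` by `c ± 4d` if `|c| >
2|d|`. Equality cannot occur, because `4 ∣ c` and `d` is odd. -/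
theorem Gamma0_four_induction {P : SL(2, ℤ) → Prop}
    (hT : ∀ γ ∈ CongruenceSubgroup.Gamma0 4, P (γ * ModularGroup.T) ↔ P γ)
    (hU : ∀ γ ∈ CongruenceSubgroup.Gamma0 4, P (γ * lowerFour) ↔ P γ)
    (h0 : ∀ γ : SL(2, ℤ), γ 1 0 = 0 → P γ) :
    ∀ γ ∈ CongruenceSubgroup.Gamma0 4, P γ := by
  suffices H : ∀ n : ℕ, ∀ γ ∈ CongruenceSubgroup.Gamma0 4,
      (γ 1 0).natAbs + (γ 1 1).natAbs = n → P γ from fun γ h => H _ γ h rfl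
  intro n
  induction n using Nat.strong_induction_on with
  | _ n ih =>
  intro γ hγ hn
  have h4 := four_dvd_of_mem_Gamma0 hγ
  have hodd := odd_of_four_dvd h4
  rw [Int.odd_iff] at hodd
  by_cases hc : γ 1 0 = 0
  · exact h0 γ hc
  have hTm := T_mem_Gamma0 4
  have hUm := lowerFour_mem_Gamma0
  have step : ∀ δ ∈ CongruenceSubgroup.Gamma0 4,
      (δ 1 0).natAbs + (δ 1 1).natAbs < n → P δ := fun δ hδ h => ih _ h δ hδ rfl
  by_cases hlt : (γ 1 0).natAbs < 2 * (γ 1 1).natAbs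
  · by_cases hs : 0 < γ 1 0 ↔ 0 < γ 1 1
    · have hm := mul_mem hγ (inv_mem hTm)
      have := (hT _ hm).2 (step _ hm (by
        rw [(mul_T_inv_row γ).1, (mul_T_inv_row γ).2]; omega))
      simpa using this
    · have hm := mul_mem hγ hTm
      exact (hT _ hγ).1 (step _ hm (by rw [(mul_T_row γ).1, (mul_T_row γ).2]; omega))
  · by_cases hs : 0 < γ 1 0 ↔ 0 < γ 1 1
    · have hm := mul_mem hγ (inv_mem hUm)
      have := (hU _ hm).2 (step _ hm (by
        rw [(mul_lowerFour_inv_row γ).1, (mul_lowerFour_inv_row γ).2]; omega))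
      simpa using this
    · have hm := mul_mem hγ hUm
      exact (hU _ hγ).1 (step _ hm (by
        rw [(mul_lowerFour_row γ).1, (mul_lowerFour_row γ).2]; omega))

theorem thetaMultiplier_mul_T {γ : SL(2, ℤ)} (hγ : γ ∈ CongruenceSubgroup.Gamma0 4) (z : ℍ) :
    thetaMultiplier (γ * ModularGroup.T) z = thetaMultiplier γ (ModularGroup.T • z) := by
  have h4 := four_dvd_of_mem_Gamma0 hγ
  unfold thetaMultiplier
  rw [(mul_T_row γ).1, (mul_T_row γ).2, shimuraSymbol_add_right h4 (odd_of_four_dvd h4),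
    eps_add h4, coe_T_smul]
  congr 2
  push_cast; ring

theorem thetaMultiplier_mul_lowerFour {γ : SL(2, ℤ)} (hγ : γ ∈ CongruenceSubgroup.Gamma0 4)
    (z : ℍ) : thetaMultiplier (γ * lowerFour) z =
      thetaMultiplier γ (lowerFour • z) * (4 * (z : ℂ) + 1) ^ (1 / 2 : ℂ) := by
  have h4 := four_dvd_of_mem_Gamma0 hγ
  have hodd := odd_of_four_dvd h4
  have hv0 : (4 * (z : ℂ) + 1) ≠ 0 := fun h => by
    have := congrArg Complex.im h; simp at this; exact z.im_ne_zero this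
  unfold thetaMultiplier
  rw [(mul_lowerFour_row γ).1, (mul_lowerFour_row γ).2, shimuraSymbol_add_left]
  set c := γ 1 0
  set d := γ 1 1
  set u : ℂ := (c : ℂ) * ((lowerFour • z : ℍ) : ℂ) + d with hu
  have huv : u * (4 * (z : ℂ) + 1) = ((c + 4 * d : ℤ) : ℂ) * z + d := by
    rw [hu, coe_lowerFour_smul]; push_cast
    rw [add_mul, mul_assoc, div_mul_cancel₀ _ hv0]; ring
  have huim : u.im = c * (lowerFour • z).im := by
    rw [hu]; simp
  have hw := (lowerFour • z).im_pos
  have hu0 : u ≠ 0 := fun h => by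
    rw [h] at huim
    have hc0 : c = 0 := by
      have : (c : ℝ) = 0 := by
        rcases mul_eq_zero.1 huim.symm with h | h
        · exact h
        · exact absurd h hw.ne'
      exact_mod_cast this
    rw [hu, hc0] at h
    have : d = 0 := by simpa using h
    rw [this] at hodd
    exact absurd hodd (by decide)
  -- For `c < 0` neither the symbol nor the square root produces a sign; for `c ≥ 0` both do exactly
  -- when `c + 4d < 0`, and the signs cancel.
  rcases lt_or_ge c 0 with hc | hc
  · rw [if_neg (by omega), ← huv, mul_cpow_half_of_neg (by simp [z.im_pos])]
    · ring
    · rw [huim]; exact mul_neg_of_neg_of_pos (by exact_mod_cast hc) hw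
  · rw [mul_cpow_half_of_nonneg z.im_pos huv hu0 (by
      rw [huim]; exact mul_nonneg (by exact_mod_cast hc) hw.le)]
    by_cases hneg : c + 4 * d < 0
    · rw [if_pos ⟨by omega, hc, hneg⟩, if_pos hneg]; push_cast; ring
    · rw [if_neg (by omega), if_neg hneg]; ring

/-- For `d = -1` the factor `ε_d⁻¹ = 1/i` cancels `√(-1) = i`. -/
theorem thetaMultiplier_of_lower_left_eq_zero {γ : SL(2, ℤ)} (h : γ 1 0 = 0) (z : ℍ) :
    thetaMultiplier γ z = 1 := by
  have h1 := det_eq_one γ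
  rw [h, mul_zero, sub_zero] at h1
  unfold thetaMultiplier
  rw [h]
  rcases Int.eq_one_or_neg_one_of_mul_eq_one' h1 with h | h
  · simp [h.2, shimuraSymbol, eps]
  · have : ((-1 : ℂ)) ^ (2⁻¹ : ℂ) = I := by
      have := sq_cpow_half (u := I) (by simp)
      simpa using this
    simp [h.2, shimuraSymbol, eps, this]

/-- A function with the right behaviour under `z ↦ z + 1` and `z ↦ z / (4z + 1)` transforms
under all of `Γ₀(4)` by the power `k` of the theta multiplier. -/
theorem transform_of_generators {f : ℍ → ℂ} {k : ℕ} (hT : ∀ z, f (ModularGroup.T • z) = f z)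
    (hU : ∀ z, f (lowerFour • z) = ((4 * (z : ℂ) + 1) ^ (1 / 2 : ℂ)) ^ k * f z) :
    ∀ γ ∈ CongruenceSubgroup.Gamma0 4, ∀ z : ℍ, f (γ • z) = thetaMultiplier γ z ^ k * f z := by
  apply Gamma0_four_induction
  · intro γ hγ
    have key : ∀ z : ℍ, f ((γ * ModularGroup.T) • z) =
        thetaMultiplier (γ * ModularGroup.T) z ^ k * f z ↔
        f (γ • (ModularGroup.T • z)) = thetaMultiplier γ (ModularGroup.T • z) ^ k *
          f (ModularGroup.T • z) := fun z => by
      rw [mul_smul, thetaMultiplier_mul_T hγ, hT]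
    refine ⟨fun h z => ?_, fun h z => (key z).2 (h _)⟩
    simpa using (key (ModularGroup.T⁻¹ • z)).1 (h _)
  · intro γ hγ
    have key : ∀ z : ℍ, f ((γ * lowerFour) • z) =
        thetaMultiplier (γ * lowerFour) z ^ k * f z ↔
        f (γ • (lowerFour • z)) = thetaMultiplier γ (lowerFour • z) ^ k *
          f (lowerFour • z) := fun z => by
      rw [mul_smul, thetaMultiplier_mul_lowerFour hγ, hU, mul_pow, mul_assoc]
    refine ⟨fun h z => ?_, fun h z => (key z).2 (h _)⟩
    simpa using (key (lowerFour⁻¹ • z)).1 (h _)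
  · intro γ hγ z
    rw [thetaMultiplier_of_lower_left_eq_zero hγ, one_pow, one_mul]
    have hTn : ∀ n : ℤ, ∀ z, f (ModularGroup.T ^ n • z) = f z := by
      intro n
      induction n with
      | zero => simp
      | succ n ih => intro z; rw [zpow_add_one, mul_smul, ih, hT]
      | pred n ih =>
        intro z
        rw [zpow_sub_one, mul_smul, ih, ← hT (ModularGroup.T⁻¹ • z), smul_inv_smul]
    obtain ⟨n, hn⟩ := ModularGroup.exists_eq_T_zpow_of_c_eq_zero hγ
    rw [hn, hTn]

end

/-! ### Convergence and termwise differentiation of theta series. -/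

section

open Complex

theorem summable_norm_prod_and_tsum_prod {ι R : Type*} [NormedField R] [CompleteSpace R] :
    ∀ {n : ℕ} {f : Fin n → ι → R} (_ : ∀ i, Summable fun k => ‖f i k‖),
      (Summable fun x : Fin n → ι => ‖∏ i, f i (x i)‖) ∧
        ∑' x : Fin n → ι, ∏ i, f i (x i) = ∏ i, ∑' k, f i k
  | 0, f, _ => by
    exact ⟨summable_of_hasFiniteSupport (Set.toFinite _), by simp⟩
  | n + 1, f, h => by
    obtain ⟨h1, h2⟩ := summable_norm_prod_and_tsum_prod (f := fun i => f i.succ) fun i => h _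
    have key : ∀ y : ι × (Fin n → ι), ∏ i, f i ((Fin.consEquiv fun _ : Fin (n + 1) => ι) y i) =
        f 0 y.1 * ∏ i : Fin n, f i.succ (y.2 i) := fun y => by
      rw [Fin.prod_univ_succ]; simp [Fin.consEquiv]
    constructor
    · rw [← (Fin.consEquiv fun _ : Fin (n + 1) => ι).summable_iff]
      refine ((h 0).mul_norm h1).congr fun y => ?_
      rw [Function.comp_apply, key]
    · rw [← (Fin.consEquiv fun _ : Fin (n + 1) => ι).tsum_eq]
      simp_rw [key]
      rw [Fin.prod_univ_succ, ← h2, tsum_mul_tsum_of_summable_norm (h 0) h1]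

/-- The product form of the bound lets the majorant of the series split into one-variable sums. -/
theorem exists_norm_eval_le {n : ℕ} (q : MvPolynomial (Fin n) ℂ) :
    ∃ (C : ℝ) (D : ℕ), 0 ≤ C ∧ ∀ y : Fin n → ℂ,
      ‖MvPolynomial.eval y q‖ ≤ C * ∏ i, (1 + ‖y i‖) ^ D := by
  induction q using MvPolynomial.induction_on with
  | C a => exact ⟨‖a‖, 0, norm_nonneg _, fun y => by simp⟩
  | add p q hp hq =>
    obtain ⟨C, D, hC, h⟩ := hp
    obtain ⟨C', D', hC', h'⟩ := hq
    refine ⟨C + C', max D D', by positivity, fun y => ?_⟩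
    rw [map_add, add_mul]
    refine (norm_add_le _ _).trans (add_le_add ((h y).trans ?_) ((h' y).trans ?_)) <;>
    · refine mul_le_mul_of_nonneg_left (Finset.prod_le_prod (fun _ _ => by positivity)
        fun i _ => pow_le_pow_right₀ (by simp) (by simp)) (by positivity)
  | mul_X p j hp =>
    obtain ⟨C, D, hC, h⟩ := hp
    refine ⟨C, D + 1, hC, fun y => ?_⟩
    rw [map_mul, norm_mul, MvPolynomial.eval_X]
    simp_rw [pow_succ]
    rw [Finset.prod_mul_distrib, ← mul_assoc]
    refine mul_le_mul (h y) ?_ (norm_nonneg _) (by positivity)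
    calc ‖y j‖ ≤ 1 + ‖y j‖ := by simp
      _ = ∏ i, if i = j then 1 + ‖y j‖ else 1 := by simp
      _ ≤ ∏ i, (1 + ‖y i‖) := Finset.prod_le_prod (fun i _ => by split_ifs <;> positivity)
          fun i _ => by split_ifs with h <;> simp [h]

/-- The general term of a theta series with polynomial coefficients `q`, scaling `σ`,
translation `v` and character `w`. -/
noncomputable def summand {n : ℕ} (q : MvPolynomial (Fin n) ℂ) (σ τ : ℂ) (v w : Fin n → ℂ)
    (x : Fin n → ℤ) : ℂ :=
  MvPolynomial.eval (fun i => σ * (x i + v i)) q *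
    exp (Real.pi * I * ∑ i, ((x i + v i) ^ 2 * τ + 2 * x i * w i))

/-- The theta series with general term `summand`. -/
noncomputable def thetaSum {n : ℕ} (q : MvPolynomial (Fin n) ℂ) (σ τ : ℂ) (v w : Fin n → ℂ) : ℂ :=
  ∑' x, summand q σ τ v w x

theorem norm_exp_pi_I_mul (z : ℂ) : ‖exp (Real.pi * I * z)‖ = Real.exp (-Real.pi * z.im) := by
  rw [norm_exp]
  congr 1
  simp

theorem neg_im_quadratic_le {S T : ℝ} {τ v w : ℂ} (k : ℤ) (hT : T ≤ τ.im)
    (hτ : ‖τ‖ ≤ S) (hv : ‖v‖ ≤ S) (hw : ‖w‖ ≤ S) :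
    -((k + v) ^ 2 * τ + 2 * k * w).im ≤ S ^ 3 - (T * k ^ 2 - 2 * (S ^ 2 + S) * |(k : ℝ)|) := by
  have hS : 0 ≤ S := (norm_nonneg _).trans hτ
  have h1 : ((k + v) ^ 2 * τ + 2 * k * w) =
      ((k ^ 2 : ℝ) : ℂ) * τ + (2 * k * (v * τ) + v ^ 2 * τ + 2 * k * w) := by push_cast; ring
  have h2 : ‖2 * k * (v * τ) + v ^ 2 * τ + 2 * k * w‖ ≤
      2 * |(k : ℝ)| * (S * S) + S ^ 2 * S + 2 * |(k : ℝ)| * S := by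
    refine (norm_add₃_le).trans ?_
    simp only [norm_mul, norm_pow, Complex.norm_intCast, Complex.norm_ofNat]
    gcongr
  have h3 := (neg_le_abs _).trans ((abs_im_le_norm _).trans h2)
  rw [h1, add_im, im_ofReal_mul]
  nlinarith [mul_le_mul_of_nonneg_left hT (sq_nonneg (k : ℝ))]

theorem summable_one_add_pow_mul_exp (K S : ℝ) {T : ℝ} (hT : 0 < T) (D : ℕ) :
    Summable fun k : ℤ => (K * (1 + |(k : ℝ)|)) ^ D *
      Real.exp (-Real.pi * (T * k ^ 2 - 2 * S * |(k : ℝ)|)) := by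
  have h0 := summable_pow_mul_jacobiTheta₂_term_bound S hT 0
  have hD := summable_pow_mul_jacobiTheta₂_term_bound S hT D
  refine Summable.of_norm_bounded ((h0.add hD).mul_left (|K| ^ D * 2 ^ (D - 1))) fun k => ?_
  rw [norm_mul, norm_pow, norm_mul, Real.norm_of_nonneg (Real.exp_pos _).le, mul_pow,
    Real.norm_of_nonneg (by positivity : 0 ≤ 1 + |(k : ℝ)|), Real.norm_eq_abs, ← add_mul,
    mul_assoc (|K| ^ D), mul_assoc (|K| ^ D), ← mul_assoc (2 ^ (D - 1))]
  have := add_pow_le (zero_le_one' ℝ) (abs_nonneg (k : ℝ)) D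
  rw [one_pow] at this
  simp only [Int.cast_abs, pow_zero]
  gcongr

/-- The majorant for the Weierstrass test, uniform in `τ`, `v` and `w` together, so that it serves
for holomorphy in `τ` and for derivatives in the other parameters. -/
theorem exists_summable_bound {n : ℕ} (q : MvPolynomial (Fin n) ℂ) (σ : ℂ) (S : ℝ) {T : ℝ}
    (hT : 0 < T) : ∃ u : (Fin n → ℤ) → ℝ, Summable u ∧
      ∀ x (τ : ℂ) (v w : Fin n → ℂ), T ≤ τ.im → ‖τ‖ ≤ S → (∀ i, ‖v i‖ ≤ S) → (∀ i, ‖w i‖ ≤ S) →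
        ‖summand q σ τ v w x‖ ≤ u x := by
  obtain ⟨C, D, hC, h⟩ := exists_norm_eval_le q
  -- `K` absorbs the scaling and the translation: `1 + |σ(x + v)| ≤ K(1 + |x|)`.
  set K := 1 + ‖σ‖ * (1 + |S|) with hK
  have hK1 : 1 ≤ K := by rw [hK]; nlinarith [norm_nonneg σ, abs_nonneg S]
  set g : ℤ → ℝ := fun k => Real.exp (Real.pi * S ^ 3) * ((K * (1 + |(k : ℝ)|)) ^ D *
      Real.exp (-Real.pi * (T * k ^ 2 - 2 * (S ^ 2 + S) * |(k : ℝ)|))) with hg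
  have hgs : Summable g := (summable_one_add_pow_mul_exp K (S ^ 2 + S) hT D).mul_left _
  refine ⟨fun x => C * ∏ i, g (x i), (Summable.of_norm
    (summable_norm_prod_and_tsum_prod (f := fun _ : Fin n => g) fun i => hgs.norm).1).mul_left C,
    fun x τ v w hτT hτ hv hw => ?_⟩
  have hS : 0 ≤ S := (norm_nonneg _).trans hτ
  rw [summand, norm_mul, norm_exp_pi_I_mul, im_sum, Finset.mul_sum, Real.exp_sum]
  refine (mul_le_mul_of_nonneg_right (h _) (by positivity)).trans ?_
  rw [mul_assoc, ← Finset.prod_mul_distrib]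
  refine mul_le_mul_of_nonneg_left (Finset.prod_le_prod (fun _ _ => by positivity)
    fun i _ => ?_) hC
  have h1 : 1 + ‖σ * ((x i : ℂ) + v i)‖ ≤ K * (1 + |(x i : ℝ)|) := by
    rw [norm_mul]
    have h2 : ‖(x i : ℂ) + v i‖ ≤ |(x i : ℝ)| + S :=
      (norm_add_le _ _).trans (add_le_add (by simp) (hv i))
    have h3 : ‖σ‖ * ‖(x i : ℂ) + v i‖ ≤ ‖σ‖ * (|(x i : ℝ)| + S) := by gcongr
    rw [hK, abs_of_nonneg hS]
    nlinarith [mul_nonneg (norm_nonneg σ) (mul_nonneg hS (abs_nonneg (x i : ℝ))),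
      norm_nonneg σ, abs_nonneg (x i : ℝ)]
  have h2 : Real.exp (-Real.pi * (((x i : ℂ) + v i) ^ 2 * τ + 2 * x i * w i).im) ≤
      Real.exp (Real.pi * S ^ 3) *
        Real.exp (-Real.pi * (T * (x i) ^ 2 - 2 * (S ^ 2 + S) * |(x i : ℝ)|)) := by
    rw [← Real.exp_add, Real.exp_le_exp]
    have := mul_le_mul_of_nonneg_left (neg_im_quadratic_le (x i) hτT hτ (hv i) (hw i))
      Real.pi_pos.le
    linarith
  rw [hg]
  calc _ ≤ (K * (1 + |(x i : ℝ)|)) ^ D * (Real.exp (Real.pi * S ^ 3) *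
        Real.exp (-Real.pi * (T * (x i) ^ 2 - 2 * (S ^ 2 + S) * |(x i : ℝ)|))) := by gcongr
    _ = _ := by ring

theorem summable_summand {n : ℕ} (q : MvPolynomial (Fin n) ℂ) (σ : ℂ) {τ : ℂ} (hτ : 0 < τ.im)
    (v w : Fin n → ℂ) : Summable (summand q σ τ v w) := by
  obtain ⟨u, hu, h⟩ := exists_summable_bound q σ (max ‖τ‖ (max ‖v‖ ‖w‖)) hτ
  exact Summable.of_norm_bounded hu fun x => h x τ v w le_rfl (le_max_left _ _)
    (fun i => (norm_le_pi_norm v i).trans (by simp)) fun i => (norm_le_pi_norm w i).trans (by simp)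

theorem summand_add {n : ℕ} (p q : MvPolynomial (Fin n) ℂ) (σ τ : ℂ) (v w : Fin n → ℂ)
    (x : Fin n → ℤ) : summand (p + q) σ τ v w x = summand p σ τ v w x + summand q σ τ v w x := by
  simp [summand, add_mul]

theorem summand_smul {n : ℕ} (a : ℂ) (q : MvPolynomial (Fin n) ℂ) (σ τ : ℂ) (v w : Fin n → ℂ)
    (x : Fin n → ℤ) : summand (a • q) σ τ v w x = a * summand q σ τ v w x := by
  simp [summand, mul_assoc, MvPolynomial.smul_eval]

theorem thetaSum_add {n : ℕ} (p q : MvPolynomial (Fin n) ℂ) (σ : ℂ) {τ : ℂ} (hτ : 0 < τ.im)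
    (v w : Fin n → ℂ) : thetaSum (p + q) σ τ v w = thetaSum p σ τ v w + thetaSum q σ τ v w := by
  simp_rw [thetaSum, summand_add]
  exact (summable_summand p σ hτ v w).tsum_add (summable_summand q σ hτ v w)

theorem thetaSum_smul {n : ℕ} (a : ℂ) (q : MvPolynomial (Fin n) ℂ) (σ τ : ℂ)
    (v w : Fin n → ℂ) : thetaSum (a • q) σ τ v w = a * thetaSum q σ τ v w := by
  simp_rw [thetaSum, summand_smul]
  exact tsum_mul_left

theorem hasDerivAt_eval {n : ℕ} (q : MvPolynomial (Fin n) ℂ) {y : ℂ → Fin n → ℂ}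
    {y' : Fin n → ℂ} {t : ℂ} (hy : ∀ i, HasDerivAt (fun t => y t i) (y' i) t) :
    HasDerivAt (fun t => MvPolynomial.eval (y t) q)
      (∑ j, MvPolynomial.eval (y t) (MvPolynomial.pderiv j q) * y' j) t := by
  induction q using MvPolynomial.induction_on with
  | C a => simpa using hasDerivAt_const t a
  | add p q hp hq =>
    simp only [map_add, add_mul, Finset.sum_add_distrib]
    exact hp.add hq
  | mul_X p i hp =>
    simp only [map_mul, MvPolynomial.eval_X]
    refine (hp.mul (hy i)).congr_deriv ?_
    simp only [Derivation.leibniz, MvPolynomial.pderiv_X, smul_eq_mul, map_add, map_mul,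
      MvPolynomial.eval_X, add_mul, Finset.sum_add_distrib, Finset.sum_mul]
    rw [add_comm]
    congr 1
    · rw [Finset.sum_eq_single i]
      · simp
      · intro j _ hj; simp [hj.symm]
      · simp
    · exact Finset.sum_congr rfl fun j _ => by ring

/-- The derivative of the general term in the direction `(a, b)` of the parameters `(v, w)`. -/
theorem hasDerivAt_summand {n : ℕ} (q : MvPolynomial (Fin n) ℂ) (σ τ : ℂ) (v w a b : Fin n → ℂ)
    (x : Fin n → ℤ) (t : ℂ) : HasDerivAt (fun t : ℂ => summand q σ τ (v + t • a) (w + t • b) x)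
      (∑ j, (σ * a j * summand (MvPolynomial.pderiv j q) σ τ (v + t • a) (w + t • b) x +
        2 * Real.pi * I * ((x j + (v + t • a) j) * a j * τ + x j * b j) *
          summand q σ τ (v + t • a) (w + t • b) x)) t := by
  have hlin : ∀ v a : Fin n → ℂ, ∀ j, HasDerivAt (fun t : ℂ => (v + t • a) j) (a j) t :=
    fun v a j => by
      simpa using ((hasDerivAt_id t).mul_const (a j)).const_add (v j)
  have h1 := hasDerivAt_eval q (y := fun t j => σ * (x j + (v + t • a) j))
    (y' := fun j => σ * a j) (t := t) fun j => ((hlin v a j).const_add _).const_mul σ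
  have h2 : HasDerivAt (fun t : ℂ => (Real.pi * I * ∑ i, ((x i + (v + t • a) i) ^ 2 * τ +
      2 * x i * (w + t • b) i) : ℂ))
      (Real.pi * I * ∑ i, (2 * (x i + (v + t • a) i) * a i * τ + 2 * x i * b i)) t := by
    refine (HasDerivAt.fun_sum fun i _ => ?_).const_mul _
    refine HasDerivAt.add ?_ ((hlin w b i).const_mul _)
    refine HasDerivAt.mul_const ?_ τ
    exact (((hlin v a i).const_add (x i : ℂ)).fun_pow 2).congr_deriv (by norm_num)
  refine (h1.mul h2.cexp).congr_deriv ?_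
  simp only [summand]
  generalize exp _ = E
  rw [Finset.sum_mul, Finset.mul_sum, Finset.mul_sum, Finset.mul_sum, ← Finset.sum_add_distrib]
  exact Finset.sum_congr rfl fun j _ => by ring

theorem hasDerivAt_thetaSum {n : ℕ} (q : MvPolynomial (Fin n) ℂ) (σ : ℂ) {τ : ℂ}
    (hτ : 0 < τ.im) (v w a b : Fin n → ℂ) :
    HasDerivAt (fun t : ℂ => thetaSum q σ τ (v + t • a) (w + t • b))
      (∑' x : Fin n → ℤ, ∑ j, (σ * a j * summand (MvPolynomial.pderiv j q) σ τ v w x +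
        2 * Real.pi * I * ((x j + v j) * a j * τ + x j * b j) * summand q σ τ v w x)) 0 := by
  obtain ⟨u, hu, h⟩ := exists_summable_bound q σ (max ‖τ‖ (max (‖v‖ + ‖a‖) (‖w‖ + ‖b‖))) hτ
  have hbd : ∀ v a : Fin n → ℂ, ∀ t ∈ Metric.ball (0 : ℂ) 1, ∀ i,
      ‖(v + t • a) i‖ ≤ ‖v‖ + ‖a‖ := fun v a t ht i => by
    refine (norm_le_pi_norm _ i).trans ((norm_add_le _ _).trans ?_)
    rw [norm_smul]
    have : ‖t‖ ≤ 1 := by simpa using (Metric.mem_ball.1 ht).le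
    nlinarith [norm_nonneg a]
  have hdiff : ∀ x, DifferentiableOn ℂ
      (fun t : ℂ => summand q σ τ (v + t • a) (w + t • b) x) (Metric.ball 0 1) := fun x t _ =>
    (hasDerivAt_summand q σ τ v w a b x t).differentiableAt.differentiableWithinAt
  have hle : ∀ x, ∀ t ∈ Metric.ball (0 : ℂ) 1,
      ‖summand q σ τ (v + t • a) (w + t • b) x‖ ≤ u x := fun x t ht =>
    h x τ _ _ le_rfl (le_max_left _ _) (fun i => (hbd v a t ht i).trans (by simp))
      fun i => (hbd w b t ht i).trans (by simp)
  have h0 : (0 : ℂ) ∈ Metric.ball (0 : ℂ) 1 := by simp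
  have hd := (differentiableOn_tsum_of_summable_norm hu hdiff Metric.isOpen_ball hle).differentiableAt
    (Metric.isOpen_ball.mem_nhds h0)
  refine hd.hasDerivAt.congr_deriv ?_
  rw [← (hasSum_deriv_of_summable_norm hu hdiff Metric.isOpen_ball hle h0).tsum_eq]
  refine tsum_congr fun x => ?_
  simpa using (hasDerivAt_summand q σ τ v w a b x 0).deriv

theorem differentiableOn_thetaSum {n : ℕ} (q : MvPolynomial (Fin n) ℂ) (σ : ℂ)
    (v w : Fin n → ℂ) :
    DifferentiableOn ℂ (fun τ => thetaSum q σ τ v w) {τ | 0 < τ.im} := by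
  intro τ₀ hτ₀
  have hτ₀' : 0 < τ₀.im := hτ₀
  obtain ⟨u, hu, h⟩ := exists_summable_bound q σ (max (‖τ₀‖ + 1) (max ‖v‖ ‖w‖)) (half_pos hτ₀')
  set U : Set ℂ := {τ | τ₀.im / 2 < τ.im} ∩ Metric.ball 0 (‖τ₀‖ + 1) with hU
  have hUo : IsOpen U := (isOpen_lt continuous_const continuous_im).inter Metric.isOpen_ball
  have hmem : τ₀ ∈ U := ⟨half_lt_self hτ₀', by simp⟩
  refine ((differentiableOn_tsum_of_summable_norm hu (U := U)
    (F := fun x τ => summand q σ τ v w x) (fun x => ?_) hUo fun x τ hτ => ?_).differentiableAt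
    (hUo.mem_nhds hmem)).differentiableWithinAt
  · unfold summand; fun_prop
  · refine h x τ v w hτ.1.le (le_trans ?_ (le_max_left _ _))
      (fun i => (norm_le_pi_norm v i).trans (by simp))
      fun i => (norm_le_pi_norm w i).trans (by simp)
    simpa using (Metric.mem_ball.1 hτ.2).le

end

/-! ### The heat operator and the inversion formula. -/

section

open Complex MvPolynomial

variable {n : ℕ}

/-- The Laplacian as a linear endomorphism. -/
noncomputable def laplacianHom (n : ℕ) : Module.End ℂ (MvPolynomial (Fin n) ℂ) :=
  ∑ i, (pderiv i).toLinearMap ∘ₗ (pderiv i).toLinearMap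

theorem laplacianHom_apply (p : MvPolynomial (Fin n) ℂ) : laplacianHom n p = laplacian p := by
  simp [laplacianHom, laplacian, LinearMap.sum_apply]

theorem laplacian_mul_X (p : MvPolynomial (Fin n) ℂ) (i : Fin n) :
    laplacian (p * X i) = laplacian p * X i + 2 * pderiv i p := by
  have h : ∀ j, pderiv j (pderiv j (p * X i)) =
      pderiv j (pderiv j p) * X i + if j = i then 2 * pderiv i p else 0 := fun j => by
    simp only [Derivation.leibniz, pderiv_X, smul_eq_mul, map_add]
    rcases eq_or_ne j i with rfl | h
    · simp; ring
    · simp [h, Ne.symm h, mul_comm]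
  simp only [laplacian, h, Finset.sum_add_distrib, Finset.sum_mul]
  simp

theorem pderiv_pderiv_comm (i j : Fin n) (p : MvPolynomial (Fin n) ℂ) :
    pderiv i (pderiv j p) = pderiv j (pderiv i p) := by
  induction p using MvPolynomial.induction_on with
  | C a => simp
  | add p q hp hq => simp only [map_add, hp, hq]
  | mul_X p k hp =>
    simp only [pderiv_mul, map_add, hp, pderiv_X, Pi.single_apply]
    split_ifs <;> simp
    ring

theorem pderiv_laplacian (p : MvPolynomial (Fin n) ℂ) (i : Fin n) :
    pderiv i (laplacian p) = laplacian (pderiv i p) := by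
  simp only [laplacian, map_sum]
  refine Finset.sum_congr rfl fun j _ => ?_
  rw [pderiv_pderiv_comm i j, pderiv_pderiv_comm i j]

/-- The commutator `[Δ, x_i] = 2∂_i` commutes with `Δ`, hence `[Δ^(k+1), x_i] = 2(k+1) ∂_i Δ^k`. -/
theorem laplacianHom_pow_mul_X (p : MvPolynomial (Fin n) ℂ) (i : Fin n) (k : ℕ) :
    (laplacianHom n ^ (k + 1)) (p * X i) = (laplacianHom n ^ (k + 1)) p * X i +
      (2 * (k + 1) : ℂ) • pderiv i ((laplacianHom n ^ k) p) := by
  have hcomm : ∀ k, pderiv i ((laplacianHom n ^ k) p) = (laplacianHom n ^ k) (pderiv i p) := by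
    intro k
    induction k with
    | zero => simp
    | succ k ih =>
      rw [pow_succ', Module.End.mul_apply, Module.End.mul_apply, ← ih, laplacianHom_apply,
        laplacianHom_apply, pderiv_laplacian]
  induction k with
  | zero =>
    simp [laplacianHom_apply, laplacian_mul_X, MvPolynomial.smul_eq_C_mul,
      show (C 2 : MvPolynomial (Fin n) ℂ) = 2 from rfl]
  | succ k ih =>
    rw [pow_succ' _ (k + 1), Module.End.mul_apply, ih, map_add, map_smul, Module.End.mul_apply,
      laplacianHom_apply, laplacian_mul_X, ← laplacianHom_apply, hcomm k, hcomm (k + 1),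
      ← Module.End.mul_apply (laplacianHom n) (laplacianHom n ^ k), ← pow_succ', add_assoc]
    congr 1
    simp only [MvPolynomial.smul_eq_C_mul]
    push_cast
    simp only [map_add, map_mul, map_one, map_natCast, map_ofNat]
    ring

/-- The truncation `∑_{k < N} s^k Δ^k / k!` of the heat operator `exp (s Δ)`. -/
noncomputable def heat (s : ℂ) (N : ℕ) (p : MvPolynomial (Fin n) ℂ) : MvPolynomial (Fin n) ℂ :=
  ∑ k ∈ Finset.range N, (s ^ k / (k.factorial : ℂ)) • (laplacianHom n ^ k) p

theorem heat_add (s : ℂ) (N : ℕ) (p q : MvPolynomial (Fin n) ℂ) :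
    heat s N (p + q) = heat s N p + heat s N q := by
  simp [heat, Finset.sum_add_distrib]

theorem heat_succ_of_pow_eq_zero (s : ℂ) {N : ℕ} {p : MvPolynomial (Fin n) ℂ}
    (h : (laplacianHom n ^ N) p = 0) : heat s (N + 1) p = heat s N p := by
  simp [heat, Finset.sum_range_succ, h]

theorem heat_succ_of_laplacian_eq_zero (s : ℂ) (N : ℕ) {p : MvPolynomial (Fin n) ℂ}
    (h : laplacian p = 0) : heat s (N + 1) p = p := by
  rw [heat, Finset.sum_range_succ']
  rw [Finset.sum_eq_zero fun k _ => by
    rw [pow_succ (laplacianHom n), Module.End.mul_apply, laplacianHom_apply, h, map_zero, smul_zero]]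
  simp

/-- Truncated form of `exp(sΔ) x_i = (x_i + 2s∂_i) exp(sΔ)`; the commutator lowers the power of `Δ`,
whence the truncation shorter by one. -/
theorem heat_mul_X (s : ℂ) (N : ℕ) (p : MvPolynomial (Fin n) ℂ) (i : Fin n) :
    heat s (N + 1) (p * X i) = heat s (N + 1) p * X i + (2 * s) • pderiv i (heat s N p) := by
  simp only [heat, Finset.sum_range_succ', laplacianHom_pow_mul_X, smul_add,
    Finset.sum_add_distrib, add_mul, Finset.sum_mul, map_sum, Finset.smul_sum]
  rw [add_right_comm]
  congr 1
  · simp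
  refine Finset.sum_congr rfl fun k _ => ?_
  rw [Derivation.map_smul, smul_smul, smul_smul]
  congr 1
  rw [Nat.factorial_succ]
  have := Nat.factorial_ne_zero k
  push_cast
  field_simp
  ring

theorem im_neg_one_div_pos {τ : ℂ} (hτ : 0 < τ.im) : 0 < (-1 / τ).im := by
  have := UpperHalfPlane.im_inv_neg_coe_pos ⟨τ, hτ⟩
  rwa [show -1 / τ = (-τ)⁻¹ by rw [inv_neg, neg_div, one_div]]

/-- The functional equation of `jacobiTheta₂` in each coordinate; its factor `exp(-πi w_i²/τ)`
completes the square and turns the character `w` into the translation `-w`. -/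
theorem thetaSum_C (a σ σ' : ℂ) {τ : ℂ} (hτ : 0 < τ.im) (w : Fin n → ℂ) :
    thetaSum (C a) σ τ 0 w = (1 / (-I * τ) ^ (1 / 2 : ℂ)) ^ n *
      thetaSum (C a) σ' (-1 / τ) (-w) 0 := by
  have hτ0 : τ ≠ 0 := fun h => by simp [h] at hτ
  have hτ' := im_neg_one_div_pos hτ
  have hs : ∀ (w : Fin n → ℂ) {τ : ℂ}, 0 < τ.im → ∀ i,
      Summable fun k => ‖jacobiTheta₂_term k (w i) τ‖ := fun w τ hτ i =>
    ((summable_jacobiTheta₂_term_iff _ _).2 hτ).norm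
  have h1 : ∀ x, summand (C a) σ τ 0 w x = a * ∏ i, jacobiTheta₂_term (x i) (w i) τ := fun x => by
    rw [summand, eval_C, Finset.mul_sum, exp_sum]
    congr 1
    refine Finset.prod_congr rfl fun i _ => ?_
    rw [jacobiTheta₂_term]
    congr 1
    simp; ring
  have h2 : ∀ x, summand (C a) σ' (-1 / τ) (-w) 0 x =
      a * (∏ i, exp (-Real.pi * I * w i ^ 2 / τ)) *
        ∏ i, jacobiTheta₂_term (x i) (w i / τ) (-1 / τ) := fun x => by
    rw [summand, eval_C, Finset.mul_sum, exp_sum, mul_assoc, ← Finset.prod_mul_distrib]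
    congr 1
    refine Finset.prod_congr rfl fun i _ => ?_
    rw [jacobiTheta₂_term, ← exp_add]
    congr 1
    simp only [Pi.neg_apply, Pi.zero_apply]
    field_simp
    ring
  simp only [thetaSum, h1, h2, tsum_mul_left]
  rw [(summable_norm_prod_and_tsum_prod (hs w hτ)).2,
    (summable_norm_prod_and_tsum_prod (f := fun i k => jacobiTheta₂_term k (w i / τ) (-1 / τ))
      (hs (fun i => w i / τ) hτ')).2]
  have h3 : ∀ i, ∑' k, jacobiTheta₂_term k (w i) τ = 1 / (-I * τ) ^ (1 / 2 : ℂ) *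
      exp (-Real.pi * I * w i ^ 2 / τ) * ∑' k, jacobiTheta₂_term k (w i / τ) (-1 / τ) :=
    fun i => jacobiTheta₂_functional_equation (w i) τ
  simp_rw [h3]
  rw [Finset.prod_mul_distrib, Finset.prod_mul_distrib, Finset.prod_const, Finset.card_univ,
    Fintype.card_fin]
  ring

theorem hasDerivAt_thetaSum_character (q : MvPolynomial (Fin n) ℂ) {σ : ℂ} (hσ : σ ≠ 0) {τ : ℂ}
    (hτ : 0 < τ.im) (w : Fin n → ℂ) (i : Fin n) :
    HasDerivAt (fun t : ℂ => thetaSum q σ τ 0 (w + t • Pi.single i 1))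
      (2 * Real.pi * I / σ * thetaSum (q * X i) σ τ 0 w) 0 := by
  have := hasDerivAt_thetaSum q σ hτ 0 w 0 (Pi.single i 1)
  simp only [smul_zero, add_zero] at this
  refine this.congr_deriv ?_
  rw [thetaSum, ← tsum_mul_left]
  refine tsum_congr fun x => ?_
  rw [Finset.sum_eq_single i]
  · simp only [summand]
    generalize exp _ = E
    simp
    field_simp
  · intro j _ hj; simp [hj]
  · simp

theorem hasDerivAt_thetaSum_translation (q : MvPolynomial (Fin n) ℂ) {τ : ℂ}
    (hτ : 0 < τ.im) (v : Fin n → ℂ) (i : Fin n) :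
    HasDerivAt (fun t : ℂ => thetaSum q 1 τ (v + t • -Pi.single i 1) 0)
      (-thetaSum (pderiv i q) 1 τ v 0 - 2 * Real.pi * I * τ * thetaSum (q * X i) 1 τ v 0) 0 := by
  have := hasDerivAt_thetaSum q 1 hτ v 0 (-Pi.single i 1) 0
  simp only [smul_zero, add_zero] at this
  refine this.congr_deriv ?_
  rw [thetaSum, thetaSum, ← tsum_mul_left, ← tsum_neg, ← ((summable_summand _ 1 hτ v 0).neg).tsum_sub
    ((summable_summand _ 1 hτ v 0).mul_left _)]
  refine tsum_congr fun x => ?_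
  rw [Finset.sum_eq_single i]
  · simp [summand]; ring
  · intro j _ hj; simp [hj]
  · simp

/-- The inversion formula for theta series with arbitrary polynomial coefficients. -/
theorem exists_thetaSum_eq_heat {τ : ℂ} (hτ : 0 < τ.im) (p : MvPolynomial (Fin n) ℂ) :
    ∃ N₀ : ℕ, ∀ N ≥ N₀, (laplacianHom n ^ N) p = 0 ∧ ∀ w : Fin n → ℂ, thetaSum p τ τ 0 w =
      (1 / (-I * τ) ^ (1 / 2 : ℂ)) ^ n *
        thetaSum (heat (-τ / (4 * Real.pi * I)) N p) 1 (-1 / τ) (-w) 0 := by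
  have hτ0 : τ ≠ 0 := fun h => by simp [h] at hτ
  have hτ' := im_neg_one_div_pos hτ
  have hpi : (Real.pi : ℂ) ≠ 0 := ofReal_ne_zero.2 Real.pi_ne_zero
  induction p using MvPolynomial.induction_on with
  | C a =>
    have hC : laplacian (C a : MvPolynomial (Fin n) ℂ) = 0 := by simp [laplacian]
    refine ⟨1, fun N hN => ?_⟩
    obtain ⟨N, rfl⟩ := Nat.exists_eq_add_of_le' hN
    rw [heat_succ_of_laplacian_eq_zero _ _ hC]
    exact ⟨by rw [pow_succ, Module.End.mul_apply, laplacianHom_apply, hC, map_zero],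
      fun w => thetaSum_C a _ _ hτ w⟩
  | add p q hp hq =>
    obtain ⟨N₁, h₁⟩ := hp
    obtain ⟨N₂, h₂⟩ := hq
    refine ⟨max N₁ N₂, fun N hN => ?_⟩
    have h₁ := h₁ N (le_of_max_le_left hN)
    have h₂ := h₂ N (le_of_max_le_right hN)
    refine ⟨by rw [map_add, h₁.1, h₂.1, add_zero], fun w => ?_⟩
    rw [heat_add, thetaSum_add _ _ _ hτ, thetaSum_add _ _ _ hτ', h₁.2, h₂.2, mul_add]
  | mul_X p i hp =>
    obtain ⟨N₀, h⟩ := hp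
    refine ⟨N₀ + 1, fun N hN => ?_⟩
    obtain ⟨N, rfl⟩ := Nat.exists_eq_add_of_le' (le_trans (Nat.le_add_left 1 N₀) hN)
    have h1 := h N (by omega)
    refine ⟨by rw [laplacianHom_pow_mul_X, h1.1, (h (N + 1) (by omega)).1]; simp, fun w => ?_⟩
    -- Since `Δ^N p = 0`, the two truncations in `heat_mul_X` coincide.
    rw [heat_mul_X, heat_succ_of_pow_eq_zero _ h1.1, thetaSum_add _ _ _ hτ', thetaSum_smul]
    set q := heat (-τ / (4 * Real.pi * I)) N p
    have d1 := hasDerivAt_thetaSum_character p hτ0 hτ w i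
    have d2 := (hasDerivAt_thetaSum_translation q hτ' (-w) i).const_mul
      ((1 / (-I * τ) ^ (1 / 2 : ℂ)) ^ n)
    have heq : (fun t : ℂ => thetaSum p τ τ 0 (w + t • Pi.single i 1)) = fun t : ℂ =>
        (1 / (-I * τ) ^ (1 / 2 : ℂ)) ^ n *
          thetaSum q 1 (-1 / τ) (-w + t • -Pi.single i 1) 0 := by
      funext t
      rw [h1.2, neg_add, smul_neg]
    rw [heq] at d1
    -- Comparing the `w_i`-derivatives of both sides and multiplying by `τ/(2πi)` gives `x_i -
    -- (τ/(2πi))∂_i` acting on `q`; this forces `2s = -τ/(2πi)`.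
    have := d1.unique d2
    field_simp at this ⊢
    linear_combination (2 : ℂ) * this

theorem eval_mul_of_isHomogeneous {ν : ℕ} {p : MvPolynomial (Fin n) ℂ}
    (h : p.IsHomogeneous ν) (t : ℂ) (y : Fin n → ℂ) :
    eval (fun i => t * y i) p = t ^ ν * eval y p := by
  rw [eval_eq', eval_eq', Finset.mul_sum]
  refine Finset.sum_congr rfl fun d hd => ?_
  have hν : ∑ i, d i = ν := by
    rw [← h (mem_support_iff.1 hd),Finsupp.weight_apply, Finsupp.sum_fintype _ _ (by simp)]
    simp
  simp_rw [mul_pow]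
  rw [Finset.prod_mul_distrib, Finset.prod_pow_eq_pow_sum, hν]
  ring

/-- The inversion formula for theta series with harmonic coefficients. -/
theorem thetaSum_inversion {ν : ℕ} {p : MvPolynomial (Fin n) ℂ} (hhom : p.IsHomogeneous ν)
    (hharm : IsHarmonic p) {τ : ℂ} (hτ : 0 < τ.im) (w : Fin n → ℂ) :
    τ ^ ν * thetaSum p 1 τ 0 w =
      (1 / (-I * τ) ^ (1 / 2 : ℂ)) ^ n * thetaSum p 1 (-1 / τ) (-w) 0 := by
  obtain ⟨N, hN⟩ := exists_thetaSum_eq_heat hτ p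
  have h := (hN (N + 1) (by omega)).2 w
  rw [heat_succ_of_laplacian_eq_zero _ _ hharm] at h
  rw [← h, thetaSum, thetaSum, ← tsum_mul_left]
  refine tsum_congr fun x => ?_
  rw [summand, summand, ← mul_assoc]
  congr 1
  simp only [one_mul]
  exact (eval_mul_of_isHomogeneous hhom τ _).symm

end

/-! ### The theta function: holomorphy, behaviour under `SL(2, ℤ)`, and the cusps. -/

section

open Complex

variable {n : ℕ}

theorem thetaTerm_eq_summand (p : MvPolynomial (Fin n) ℂ) (z : ℍ) :
    thetaTerm p z = summand p 1 (2 * z) 0 0 := by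
  funext x
  rw [thetaTerm, summand, e]
  simp only [Pi.zero_apply, add_zero, mul_zero, one_mul, ← Finset.sum_mul]
  congr 2
  ring

theorem theta_eq_thetaSum (p : MvPolynomial (Fin n) ℂ) (z : ℍ) :
    theta p z = thetaSum p 1 (2 * z) 0 0 := by
  rw [theta, thetaTerm_eq_summand, thetaSum]

theorem im_two_mul_pos (z : ℍ) : 0 < (2 * (z : ℂ)).im := by
  simp [z.im_pos]

theorem summable_thetaTerm (p : MvPolynomial (Fin n) ℂ) (z : ℍ) : Summable (thetaTerm p z) := by
  rw [thetaTerm_eq_summand]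
  exact summable_summand p 1 (im_two_mul_pos z) 0 0

theorem mdifferentiable_theta (p : MvPolynomial (Fin n) ℂ) :
    MDifferentiable 𝓘(ℂ) 𝓘(ℂ) (theta p) := by
  rw [UpperHalfPlane.mdifferentiable_iff]
  have : DifferentiableOn ℂ (fun z : ℂ => thetaSum p 1 (2 * z) 0 0) {z | 0 < z.im} :=
    (differentiableOn_thetaSum p 1 0 0).comp (by fun_prop) fun z hz => by
      simpa using hz
  refine this.congr fun z hz => ?_
  rw [Function.comp_apply, theta_eq_thetaSum, UpperHalfPlane.ofComplex_apply_of_im_pos hz]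

theorem exp_pi_I_mul_eq {x y : ℂ} (m : ℤ) (h : x = y + 2 * m) :
    exp (Real.pi * I * x) = exp (Real.pi * I * y) := by
  rw [exp_eq_exp_iff_exists_int]
  exact ⟨m, by rw [h]; ring⟩

theorem exists_mul_sub_one_eq (x : Fin n → ℤ) : ∃ m : ℤ, ∑ i, x i * (x i - 1) = 2 * m := by
  have : Even (∑ i, x i * (x i - 1)) := Finset.even_sum _ fun i _ => Int.even_mul_pred_self _
  obtain ⟨m, hm⟩ := this
  exact ⟨m, by rw [hm]; ring⟩

/-- The constant vector with entries `1/2`. -/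
noncomputable def halves (n : ℕ) : Fin n → ℂ := fun _ => 1 / 2

/-- Because `x² ≡ x mod 2`, the shift introduces the sign `(-1)^(∑ x_i)`, which is the character
`1/2`. -/
theorem thetaSum_add_one (p : MvPolynomial (Fin n) ℂ) (τ : ℂ) :
    thetaSum p 1 (τ + 1) 0 0 = thetaSum p 1 τ 0 (halves n) := by
  refine tsum_congr fun x => ?_
  obtain ⟨m, hm⟩ := exists_mul_sub_one_eq x
  have hm' : ∑ i, (x i : ℂ) * (x i - 1) = 2 * m := by exact_mod_cast hm
  rw [summand, summand, exp_pi_I_mul_eq m]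
  rw [← hm', ← Finset.sum_add_distrib]
  refine Finset.sum_congr rfl fun i _ => ?_
  simp only [halves, Pi.zero_apply]
  ring

theorem thetaSum_halves_add_one (p : MvPolynomial (Fin n) ℂ) (τ : ℂ) :
    thetaSum p 1 (τ + 1) 0 (halves n) = thetaSum p 1 τ 0 0 := by
  refine tsum_congr fun x => ?_
  obtain ⟨m, hm⟩ := exists_mul_sub_one_eq x
  have hm' : ∑ i, (x i : ℂ) * (x i - 1) = 2 * m := by exact_mod_cast hm
  rw [summand, summand, exp_pi_I_mul_eq (m + ∑ i, x i)]
  push_cast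
  rw [mul_add, ← hm', Finset.mul_sum, ← Finset.sum_add_distrib, ← Finset.sum_add_distrib]
  refine Finset.sum_congr rfl fun i _ => ?_
  simp only [halves, Pi.zero_apply]
  ring

/-- As `(x - 1/2)² = x(x - 1) + 1/4` with `x(x - 1)` even, every term acquires the same factor
`e^(πi n/4)`. -/
theorem norm_thetaSum_neg_halves_add_one (p : MvPolynomial (Fin n) ℂ) (τ : ℂ) :
    ‖thetaSum p 1 (τ + 1) (-halves n) 0‖ = ‖thetaSum p 1 τ (-halves n) 0‖ := by
  have h1 : ∀ x, summand p 1 (τ + 1) (-halves n) 0 x =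
      exp (Real.pi * I * ((n / 4 : ℝ) : ℂ)) * summand p 1 τ (-halves n) 0 x := fun x => by
    obtain ⟨m, hm⟩ := exists_mul_sub_one_eq x
    have hm' : ∑ i, (x i : ℂ) * (x i - 1) = 2 * m := by exact_mod_cast hm
    rw [summand, summand, mul_left_comm, ← exp_add, ← mul_add, exp_pi_I_mul_eq m]
    have hn : ((n / 4 : ℝ) : ℂ) = ∑ _i : Fin n, (1 / 4 : ℂ) := by
      simp; ring
    rw [← hm', hn, ← Finset.sum_add_distrib, ← Finset.sum_add_distrib]
    refine Finset.sum_congr rfl fun i _ => ?_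
    simp only [halves, Pi.zero_apply, Pi.neg_apply]
    ring
  simp only [thetaSum, h1, tsum_mul_left, norm_mul, norm_exp_pi_I_mul, ofReal_im]
  simp

theorem norm_cpow_half (u : ℂ) : ‖u ^ (1 / 2 : ℂ)‖ = ‖u‖ ^ (1 / 2 : ℝ) := by
  rw [← Real.sqrt_eq_rpow, eq_comm, Real.sqrt_eq_iff_mul_self_eq (norm_nonneg _) (norm_nonneg _),
    ← norm_mul, ← pow_two, cpow_half_sq]

theorem norm_thetaSum_inversion {ν : ℕ} {p : MvPolynomial (Fin n) ℂ} (hhom : p.IsHomogeneous ν)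
    (hharm : IsHarmonic p) {τ : ℂ} (hτ : 0 < τ.im) (w : Fin n → ℂ) :
    ‖thetaSum p 1 (-1 / τ) (-w) 0‖ = ‖τ‖ ^ (ν + n / 2 : ℝ) * ‖thetaSum p 1 τ 0 w‖ := by
  have hτ0 : τ ≠ 0 := fun h => by simp [h] at hτ
  have hpos : 0 < ‖τ‖ := norm_pos_iff.2 hτ0
  have h := congrArg norm (thetaSum_inversion hhom hharm hτ w)
  rw [norm_mul, norm_mul, norm_pow, norm_pow, norm_div, norm_cpow_half, norm_mul, norm_neg, norm_I,
    one_mul, norm_one, one_div, inv_pow, ← Real.rpow_natCast (_ ^ (1 / 2 : ℝ)),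
    ← Real.rpow_mul hpos.le] at h
  have h2 : ‖τ‖ ^ (ν + n / 2 : ℝ) = ‖τ‖ ^ ν * ‖τ‖ ^ (1 / 2 * n : ℝ) := by
    rw [Real.rpow_add hpos, Real.rpow_natCast]; ring_nf
  have h3 : ‖τ‖ ^ (1 / 2 * n : ℝ) ≠ 0 := (Real.rpow_pos_of_pos hpos _).ne'
  rw [h2, mul_right_comm, h]
  field_simp

/-- The automorphy factor `cz + d`. -/
noncomputable def denominator (g : SL(2, ℤ)) (z : ℍ) : ℂ := (g 1 0 : ℂ) * (z : ℂ) + (g 1 1 : ℂ)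

theorem denominator_ne_zero (g : SL(2, ℤ)) (z : ℍ) : denominator g z ≠ 0 := by
  have := UpperHalfPlane.denom_ne_zero (g : GL (Fin 2) ℝ) z
  simpa [UpperHalfPlane.denom, denominator] using this

theorem coe_smul_eq_div (g : SL(2, ℤ)) (z : ℍ) :
    ((g • z : ℍ) : ℂ) = ((g 0 0 : ℂ) * z + g 0 1) / denominator g z := by
  rw [UpperHalfPlane.specialLinearGroup_apply]
  simp [denominator]

theorem denominator_mul (g h : SL(2, ℤ)) (z : ℍ) :
    denominator (g * h) z = denominator g (h • z) * denominator h z := by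
  have h0 := denominator_ne_zero h z
  rw [denominator, denominator, coe_smul_eq_div, add_mul, mul_assoc, div_mul_cancel₀ _ h0,
    denominator]
  simp only [Matrix.SpecialLinearGroup.coe_mul, Matrix.mul_apply, Fin.sum_univ_two]
  push_cast
  ring

/-- `f ∣ g` agrees with `f'` up to a factor of absolute value `1`, in weight `k`. -/
def NormSlash (k : ℝ) (g : SL(2, ℤ)) (f f' : ℂ → ℂ) : Prop :=
  ∀ τ : ℍ, ‖f (g • τ : ℍ)‖ = ‖denominator g τ‖ ^ k * ‖f' τ‖

theorem NormSlash.mul {k : ℝ} {g h : SL(2, ℤ)} {f₁ f₂ f₃ : ℂ → ℂ} (h₁ : NormSlash k g f₁ f₂)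
    (h₂ : NormSlash k h f₂ f₃) : NormSlash k (g * h) f₁ f₃ := fun τ => by
  rw [mul_smul, h₁, h₂, denominator_mul, norm_mul, Real.mul_rpow (norm_nonneg _) (norm_nonneg _),
    mul_assoc]

/-- The three theta functions with half-integral characteristics permuted by `SL(2, ℤ)`. -/
def thetaFamily (p : MvPolynomial (Fin n) ℂ) : Set (ℂ → ℂ) :=
  {fun τ => thetaSum p 1 τ 0 0, fun τ => thetaSum p 1 τ 0 (halves n),
    fun τ => thetaSum p 1 τ (-halves n) 0}

theorem coe_S_smul (τ : ℍ) : ((ModularGroup.S • τ : ℍ) : ℂ) = -1 / τ := by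
  rw [UpperHalfPlane.modular_S_smul]
  simp [neg_div, inv_neg]

theorem normSlash_S {ν : ℕ} {p : MvPolynomial (Fin n) ℂ} (hhom : p.IsHomogeneous ν)
    (hharm : IsHarmonic p) : ∀ f ∈ thetaFamily p, ∃ f' ∈ thetaFamily p,
      NormSlash (ν + n / 2) ModularGroup.S f f' := by
  have hden : ∀ τ : ℍ, denominator ModularGroup.S τ = τ := fun τ => by
    simp [denominator, ModularGroup.coe_S]
  rintro f (rfl | rfl | rfl)
  · refine ⟨_, Or.inl rfl, fun τ => ?_⟩
    simp only [coe_S_smul, hden]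
    simpa using norm_thetaSum_inversion hhom hharm τ.im_pos 0
  · refine ⟨_, Or.inr (Or.inr rfl), fun τ => ?_⟩
    simp only [coe_S_smul, hden]
    -- Inversion turns characters into translations, so it is applied at `-1/τ` and read backwards.
    have h := norm_thetaSum_inversion hhom hharm (im_neg_one_div_pos τ.im_pos) (halves n)
    have hτ : 0 < ‖(τ : ℂ)‖ := norm_pos_iff.2 τ.ne_zero
    have hinv : -1 / (-1 / (τ : ℂ)) = τ := by field_simp
    rw [hinv, norm_div, norm_neg, norm_one, one_div, Real.inv_rpow hτ.le] at h
    rw [h, mul_inv_cancel_left₀ (Real.rpow_pos_of_pos hτ _).ne']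
  · refine ⟨_, Or.inr (Or.inl rfl), fun τ => ?_⟩
    simp only [coe_S_smul, hden]
    exact norm_thetaSum_inversion hhom hharm τ.im_pos (halves n)

theorem normSlash_S_inv {k : ℝ} {f f' : ℂ → ℂ} (h : NormSlash k ModularGroup.S f f') :
    NormSlash k ModularGroup.S⁻¹ f f' := fun τ => by
  have h1 : ModularGroup.S⁻¹ = -ModularGroup.S := by
    ext i j
    rw [Matrix.SpecialLinearGroup.coe_inv, Matrix.SpecialLinearGroup.coe_neg, ModularGroup.coe_S,
      Matrix.adjugate_fin_two]
    fin_cases i <;> fin_cases j <;> simp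
  have h2 : denominator (-ModularGroup.S) τ = -denominator ModularGroup.S τ := by
    simp [denominator, Matrix.SpecialLinearGroup.coe_neg]
  rw [h1, ModularGroup.SL_neg_smul, h τ, h2, norm_neg]

theorem normSlash_T (p : MvPolynomial (Fin n) ℂ) (k : ℝ) : ∀ f ∈ thetaFamily p,
    ∃ f' ∈ thetaFamily p, NormSlash k ModularGroup.T f f' := by
  have hden : ∀ τ : ℍ, denominator ModularGroup.T τ = 1 := fun τ => by
    simp [denominator, ModularGroup.coe_T]
  rintro f (rfl | rfl | rfl)
  · refine ⟨_, Or.inr (Or.inl rfl), fun τ => ?_⟩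
    simp only [coe_T_smul, hden, thetaSum_add_one]
    simp
  · refine ⟨_, Or.inl rfl, fun τ => ?_⟩
    simp only [coe_T_smul, hden, thetaSum_halves_add_one]
    simp
  · refine ⟨_, Or.inr (Or.inr rfl), fun τ => ?_⟩
    simp only [coe_T_smul, hden, norm_thetaSum_neg_halves_add_one]
    simp

theorem coe_T_inv_smul (z : ℍ) : ((ModularGroup.T⁻¹ • z : ℍ) : ℂ) = z - 1 := by
  have := coe_T_smul (ModularGroup.T⁻¹ • z)
  rw [smul_inv_smul] at this
  rw [this]; ring

theorem normSlash_T_inv (p : MvPolynomial (Fin n) ℂ) (k : ℝ) : ∀ f ∈ thetaFamily p,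
    ∃ f' ∈ thetaFamily p, NormSlash k ModularGroup.T⁻¹ f f' := by
  have hden : ∀ τ : ℍ, denominator ModularGroup.T⁻¹ τ = 1 := fun τ => by
    simp [denominator]
  rintro f (rfl | rfl | rfl)
  · refine ⟨_, Or.inr (Or.inl rfl), fun τ => ?_⟩
    simp only [coe_T_inv_smul, hden]
    rw [← thetaSum_halves_add_one, sub_add_cancel]
    simp
  · refine ⟨_, Or.inl rfl, fun τ => ?_⟩
    simp only [coe_T_inv_smul, hden]
    rw [← thetaSum_add_one, sub_add_cancel]
    simp
  · refine ⟨_, Or.inr (Or.inr rfl), fun τ => ?_⟩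
    simp only [coe_T_inv_smul, hden]
    rw [← norm_thetaSum_neg_halves_add_one, sub_add_cancel]
    simp

theorem exists_normSlash {ν : ℕ} {p : MvPolynomial (Fin n) ℂ} (hhom : p.IsHomogeneous ν)
    (hharm : IsHarmonic p) (g : SL(2, ℤ)) : ∀ f ∈ thetaFamily p, ∃ f' ∈ thetaFamily p,
      NormSlash (ν + n / 2) g f f' := by
  have hg : g ∈ Subgroup.closure {ModularGroup.S, ModularGroup.T} := by
    rw [SpecialLinearGroup.SL2Z_generators]; trivial
  -- The claim is carried for `g` and `g⁻¹` together, so that the inverse step is a swap.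
  refine (Subgroup.closure_induction
    (p := fun g _ => (∀ f ∈ thetaFamily p, ∃ f' ∈ thetaFamily p, NormSlash (ν + n / 2) g f f') ∧
      ∀ f ∈ thetaFamily p, ∃ f' ∈ thetaFamily p, NormSlash (ν + n / 2) g⁻¹ f f')
    ?_ ?_ ?_ ?_ hg).1
  · rintro x (rfl | rfl)
    · refine ⟨normSlash_S hhom hharm, fun f hf => ?_⟩
      obtain ⟨f', hf', h⟩ := normSlash_S hhom hharm f hf
      exact ⟨f', hf', normSlash_S_inv h⟩
    · exact ⟨normSlash_T p _, normSlash_T_inv p _⟩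
  · have h1 : ∀ f ∈ thetaFamily p, ∃ f' ∈ thetaFamily p, NormSlash (ν + n / 2) 1 f f' :=
      fun f hf => ⟨f, hf, fun τ => by simp [denominator]⟩
    exact ⟨h1, by rwa [inv_one]⟩
  · have hmul : ∀ g h : SL(2, ℤ),
        (∀ f ∈ thetaFamily p, ∃ f' ∈ thetaFamily p, NormSlash (ν + n / 2) g f f') →
        (∀ f ∈ thetaFamily p, ∃ f' ∈ thetaFamily p, NormSlash (ν + n / 2) h f f') →
        ∀ f ∈ thetaFamily p, ∃ f' ∈ thetaFamily p, NormSlash (ν + n / 2) (g * h) f f' := by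
      intro g h h₁ h₂ f hf
      obtain ⟨f', hf', h'⟩ := h₁ f hf
      obtain ⟨f'', hf'', h''⟩ := h₂ f' hf'
      exact ⟨f'', hf'', h'.mul h''⟩
    intro x y _ _ hx hy
    rw [mul_inv_rev]
    exact ⟨hmul x y hx.1 hy.1, hmul _ _ hy.2 hx.2⟩
  · intro x _ hx
    rw [inv_inv]
    exact ⟨hx.2, hx.1⟩

/-- Comparison with `τ = i`: for a real shift the quadratic form is real, so `|term|` depends on `τ`
only through `Im τ`. -/
theorem norm_summand_ofReal (q : MvPolynomial (Fin n) ℂ) (σ τ : ℂ) (r : ℝ) (w : Fin n → ℂ)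
    (x : Fin n → ℤ) : ‖summand q σ τ (fun _ => (r : ℂ)) w x‖ =
      Real.exp (-Real.pi * (∑ i, ((x i : ℝ) + r) ^ 2) * (τ.im - 1)) *
        ‖summand q σ I (fun _ => (r : ℂ)) w x‖ := by
  have h : ∀ τ : ℂ, (∑ i, (((x i : ℂ) + r) ^ 2 * τ + 2 * x i * w i)).im =
      (∑ i, ((x i : ℝ) + r) ^ 2) * τ.im + (∑ i, 2 * x i * w i).im := fun τ => by
    rw [Finset.sum_add_distrib, add_im, ← Finset.sum_mul, ← im_ofReal_mul]
    push_cast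
    rfl
  rw [summand, summand, norm_mul, norm_mul, norm_exp_pi_I_mul, norm_exp_pi_I_mul, h, h,
    mul_left_comm, ← Real.exp_add, I_im]
  congr 2
  ring

theorem norm_thetaSum_le_of_le_sum_sq (q : MvPolynomial (Fin n) ℂ) (σ : ℂ) (r : ℝ)
    (w : Fin n → ℂ) {δ : ℝ} (hδ : ∀ x : Fin n → ℤ, MvPolynomial.eval
      (fun i => σ * ((x i : ℂ) + r)) q ≠ 0 → δ ≤ ∑ i, ((x i : ℝ) + r) ^ 2) :
    ∃ M : ℝ, ∀ τ : ℂ, 1 ≤ τ.im →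
      ‖thetaSum q σ τ (fun _ => (r : ℂ)) w‖ ≤ Real.exp (-Real.pi * δ * (τ.im - 1)) * M := by
  refine ⟨∑' x, ‖summand q σ I (fun _ => (r : ℂ)) w x‖, fun τ hτ => ?_⟩
  have hs : Summable fun x => ‖summand q σ I (fun _ => (r : ℂ)) w x‖ :=
    (summable_summand q σ (by simp) _ w).norm
  rw [← tsum_mul_left]
  refine tsum_of_norm_bounded (hs.mul_left _).hasSum fun x => ?_
  rw [norm_summand_ofReal]
  by_cases h0 : MvPolynomial.eval (fun i => σ * ((x i : ℂ) + r)) q = 0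
  · simp [summand, h0]
  · refine mul_le_mul_of_nonneg_right (Real.exp_le_exp.2 ?_) (norm_nonneg _)
    have := mul_le_mul_of_nonneg_left (hδ x h0) (mul_nonneg Real.pi_pos.le (sub_nonneg.2 hτ))
    nlinarith

theorem eval_zero_of_isHomogeneous {ν : ℕ} {p : MvPolynomial (Fin n) ℂ}
    (h : p.IsHomogeneous ν) (hν : 0 < ν) : MvPolynomial.eval (fun _ => (0 : ℂ)) p = 0 := by
  simpa [hν.ne'] using eval_mul_of_isHomogeneous h 0 0

/-- The constant `1/4` bounds `∑ (x_i - 1/2)²` from below for `n > 0`. In the unshifted series the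
nonzero terms have `|x|² ≥ 1`, since `ν > 0` removes `x = 0`. -/
theorem exists_norm_le_of_mem_thetaFamily (hn : 0 < n) {ν : ℕ} (hν : 0 < ν)
    {p : MvPolynomial (Fin n) ℂ} (hhom : p.IsHomogeneous ν) {f : ℂ → ℂ} (hf : f ∈ thetaFamily p) :
    ∃ M : ℝ, ∀ τ : ℂ, 1 ≤ τ.im → ‖f τ‖ ≤ Real.exp (-Real.pi * (1 / 4) * (τ.im - 1)) * M := by
  have h0 : ∀ x : Fin n → ℤ, MvPolynomial.eval (fun i => 1 * ((x i : ℂ) + (0 : ℝ))) p ≠ 0 →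
      (1 / 4 : ℝ) ≤ ∑ i, ((x i : ℝ) + 0) ^ 2 := by
    intro x hx
    obtain ⟨i, hi⟩ : ∃ i, x i ≠ 0 := by
      by_contra! hcon
      exact hx (by simpa [hcon] using eval_zero_of_isHomogeneous hhom hν)
    have h1 : (1 : ℝ) ≤ (x i : ℝ) ^ 2 := by
      exact_mod_cast Int.one_le_abs (sq_pos_of_ne_zero hi |>.ne') |>.trans_eq (abs_of_nonneg (sq_nonneg _))
    have h2 := Finset.single_le_sum (f := fun i => ((x i : ℝ) + 0) ^ 2)
      (fun i _ => sq_nonneg _) (Finset.mem_univ i)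
    simp only [add_zero] at h2 ⊢
    linarith
  have hv0 : (0 : Fin n → ℂ) = fun _ => ((0 : ℝ) : ℂ) := by funext; simp
  have hvh : -halves n = fun _ => ((-(1 / 2) : ℝ) : ℂ) := by funext; simp [halves]
  rcases hf with rfl | rfl | rfl
  · have := norm_thetaSum_le_of_le_sum_sq p 1 0 0 h0
    rwa [← hv0] at this
  · have := norm_thetaSum_le_of_le_sum_sq p 1 0 (halves n) h0
    rwa [← hv0] at this
  · have := norm_thetaSum_le_of_le_sum_sq p 1 (-(1 / 2)) 0 (δ := 1 / 4) fun x _ => by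
      have h1 : ∀ i, (1 / 4 : ℝ) ≤ ((x i : ℝ) + -(1 / 2)) ^ 2 := fun i => by
        have h2 : (0 : ℝ) ≤ x i * (x i - 1) := by
          have : 0 ≤ x i * (x i - 1) := by
            rcases le_or_gt (x i) 0 with h | h <;> nlinarith
          exact_mod_cast this
        nlinarith
      exact (h1 ⟨0, hn⟩).trans (Finset.single_le_sum (f := fun i => ((x i : ℝ) + -(1 / 2)) ^ 2)
        (fun i _ => sq_nonneg _) (Finset.mem_univ _))
    rwa [← hvh] at this

theorem theta_T_smul (p : MvPolynomial (Fin n) ℂ) (z : ℍ) :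
    theta p (ModularGroup.T • z) = theta p z := by
  rw [theta_eq_thetaSum, theta_eq_thetaSum, coe_T_smul,
    show 2 * ((z : ℂ) + 1) = 2 * z + 1 + 1 by ring, thetaSum_add_one, thetaSum_halves_add_one]

theorem cpow_half_re_im {u : ℂ} (hu : 0 < u.re) :
    |(u ^ (1 / 2 : ℂ)).im| < (u ^ (1 / 2 : ℂ)).re := by
  have h1 := cpow_half_sq u
  have h2 := cpow_half_nonneg (u := u) fun h => by simp [h] at hu
  have h3 := congrArg Complex.re h1
  rw [pow_two, mul_re] at h3
  have h4 : 0 ≤ (u ^ (1 / 2 : ℂ)).re := h2.elim le_of_lt fun h => h.1.ge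
  exact abs_lt_of_sq_lt_sq (by nlinarith) h4

/-- Roots of numbers in the right half plane have argument in `(-π/4, π/4)`, so the quotient of two
of them stays in the right half plane and is the principal root of `u`. -/
theorem cpow_half_eq_mul {τ τ' u : ℂ} (hτ : 0 < τ.im) (hτ' : 0 < τ'.im) (h : τ = u * τ') :
    (-I * τ) ^ (1 / 2 : ℂ) = u ^ (1 / 2 : ℂ) * (-I * τ') ^ (1 / 2 : ℂ) := by
  have h1 := cpow_half_re_im (u := -I * τ) (by simpa using hτ)
  have h2 := cpow_half_re_im (u := -I * τ') (by simpa using hτ')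
  have h1s := cpow_half_sq (-I * τ)
  have h2s := cpow_half_sq (-I * τ')
  set s := (-I * τ) ^ (1 / 2 : ℂ)
  set t := (-I * τ') ^ (1 / 2 : ℂ)
  have ht0 : t ≠ 0 := fun h => by simp [h] at h2
  have hτ0 : τ' ≠ 0 := fun h => by simp [h] at hτ'
  have hsq : (s / t) ^ 2 = u := by
    rw [div_pow, h1s, h2s, h]
    field_simp
  have hre : 0 < (s / t).re := by
    rw [div_re, ← add_div]
    refine div_pos ?_ (normSq_pos.2 ht0)
    rw [abs_lt] at h1 h2
    nlinarith
  rw [← hsq, sq_cpow_half (Or.inl hre), div_mul_cancel₀ _ ht0]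

theorem theta_lowerFour_smul {ν : ℕ} {p : MvPolynomial (Fin n) ℂ} (hhom : p.IsHomogeneous ν)
    (hharm : IsHarmonic p) (z : ℍ) : theta p (lowerFour • z) =
      ((4 * (z : ℂ) + 1) ^ (1 / 2 : ℂ)) ^ (2 * ν + n) * theta p z := by
  have hτ := im_two_mul_pos z
  have hτ' := im_two_mul_pos (lowerFour • z)
  have hv0 : (4 * (z : ℂ) + 1) ≠ 0 := fun h => by
    have := congrArg Complex.im h; simp at this; exact z.im_ne_zero this
  have hz0 := z.ne_zero
  have h1 := thetaSum_inversion hhom hharm hτ 0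
  have h2 := thetaSum_inversion hhom hharm hτ' 0
  have hrel : 2 * (z : ℂ) = (4 * (z : ℂ) + 1) * (2 * ((lowerFour • z : ℍ) : ℂ)) := by
    rw [coe_lowerFour_smul]
    linear_combination (-2) * div_mul_cancel₀ (z : ℂ) hv0
  -- With `τ = 2z`, the map `z ↦ z / (4z + 1)` becomes `-1/τ ↦ -1/τ - 2`, and 2 is a period.
  have hper : thetaSum p 1 (-1 / (2 * ((lowerFour • z : ℍ) : ℂ))) (-0) 0 =
      thetaSum p 1 (-1 / (2 * (z : ℂ))) (-0) 0 := by
    have : -1 / (2 * (z : ℂ)) = -1 / (2 * ((lowerFour • z : ℍ) : ℂ)) + 1 + 1 := by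
      rw [coe_lowerFour_smul]; field_simp; ring
    rw [neg_zero, this, thetaSum_add_one, thetaSum_halves_add_one]
  rw [hper] at h2
  have hs := cpow_half_eq_mul hτ hτ' hrel
  have hs0 : (-I * (2 * (z : ℂ))) ^ (1 / 2 : ℂ) ≠ 0 := fun h => by
    have := cpow_half_sq (-I * (2 * (z : ℂ)))
    rw [h] at this
    simp at this
    exact hz0 this
  rw [theta_eq_thetaSum, theta_eq_thetaSum, pow_add, pow_mul, cpow_half_sq]
  rw [hs] at h1 hs0
  have ht0 := right_ne_zero_of_mul hs0
  have hw0 : 2 * ((lowerFour • z : ℍ) : ℂ) ≠ 0 :=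
    mul_ne_zero two_ne_zero (lowerFour • z).ne_zero
  have h2' := h2
  rw [one_div, inv_pow, eq_inv_mul_iff_mul_eq₀ (pow_ne_zero _ ht0)] at h2'
  rw [one_div, inv_pow, eq_inv_mul_iff_mul_eq₀ (pow_ne_zero _ hs0), ← h2', mul_pow] at h1
  nth_rewrite 1 [hrel] at h1
  rw [mul_pow] at h1
  refine mul_left_cancel₀ (mul_ne_zero (pow_ne_zero n ht0) (pow_ne_zero ν hw0)) ?_
  linear_combination -h1

/-- Multiplication by two after `g` is, up to an element of `SL(2, ℤ)`, a linear map. -/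
theorem exists_two_mul_smul (g : SL(2, ℤ)) : ∃ (g' : SL(2, ℤ)) (t K : ℝ), 0 < t ∧ 0 < K ∧
    ∀ z : ℍ, ∃ z' : ℍ, z'.im = t * z.im ∧ 2 * ((g • z : ℍ) : ℂ) = (g' • z' : ℍ) ∧
      ‖denominator g' z'‖ = K * ‖denominator g z‖ := by
  have hdet := det_eq_one g
  -- Factor `diag(2, 1) g = g' h` with `h` upper triangular of determinant 2: `h = diag(2, 1)` when
  -- the lower left entry is even, and `h = (1 d; 0 2)` with `d` the lower right entry of `g` when
  -- it is odd.
  rcases Int.even_or_odd (g 1 0) with ⟨c, hc⟩ | ⟨c, hc⟩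
  · obtain ⟨g', hg'⟩ : ∃ g' : SL(2, ℤ), g'.1 = !![g 0 0, 2 * g 0 1; c, g 1 1] :=
      ⟨⟨_, by rw [Matrix.det_fin_two_of]; rw [hc] at hdet; linear_combination hdet⟩, rfl⟩
    refine ⟨g', 2, 1, by norm_num, by norm_num, fun z =>
      ⟨⟨2 * z, im_two_mul_pos z⟩, by simp [← UpperHalfPlane.coe_im], ?_⟩⟩
    have hden : denominator g' ⟨2 * z, im_two_mul_pos z⟩ = denominator g z := by
      simp [denominator, hg', hc]; ring
    refine ⟨?_, by rw [hden, one_mul]⟩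
    rw [coe_smul_eq_div, coe_smul_eq_div, hden]
    simp [hg']
    ring
  · have him (z : ℍ) : 0 < (((z : ℂ) + g 1 1) / 2).im := by simp [z.im_pos]
    obtain ⟨g', hg'⟩ : ∃ g' : SL(2, ℤ),
        g'.1 = !![2 * g 0 0, g 0 1 - g 0 0 * g 1 1; g 1 0, -c * g 1 1] :=
      ⟨⟨_, by rw [Matrix.det_fin_two_of]; rw [hc] at hdet ⊢; linear_combination hdet⟩, rfl⟩
    refine ⟨g', 1 / 2, 1 / 2, by norm_num, by norm_num, fun z =>
      ⟨⟨((z : ℂ) + g 1 1) / 2, him z⟩, by simp [← UpperHalfPlane.coe_im]; ring, ?_⟩⟩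
    have hden : denominator g' ⟨((z : ℂ) + g 1 1) / 2, him z⟩ = 1 / 2 * denominator g z := by
      simp [denominator, hg', hc]; ring
    refine ⟨?_, by rw [hden, norm_mul]; norm_num⟩
    have h0 := denominator_ne_zero g z
    rw [coe_smul_eq_div, coe_smul_eq_div, hden]
    simp [hg']
    field_simp
    ring

theorem isZeroAtImInfty_theta (hn : 0 < n) {ν : ℕ} (hν : 0 < ν) {p : MvPolynomial (Fin n) ℂ}
    (hhom : p.IsHomogeneous ν) (hharm : IsHarmonic p) (g : SL(2, ℤ)) :
    UpperHalfPlane.IsZeroAtImInfty fun z : ℍ =>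
      ((g 1 0 : ℂ) * (z : ℂ) + (g 1 1 : ℂ)) ^ (-((2 * ν + n : ℕ) : ℂ) / 2) * theta p (g • z) := by
  obtain ⟨g', t, K, ht, hK, hg'⟩ := exists_two_mul_smul g
  -- The automorphy factors of `g'` and `g` differ by the constant `K` in absolute value, so the
  -- weight factor cancels and the decay of `f` at `Im z' = t Im z` remains.
  obtain ⟨f, hf, hfs⟩ := exists_normSlash hhom hharm g' _ (Or.inl rfl)
  obtain ⟨M, hM⟩ := exists_norm_le_of_mem_thetaFamily hn hν hhom hf
  have hbound : ∀ z : ℍ, 1 ≤ t * z.im →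
      ‖((g 1 0 : ℂ) * (z : ℂ) + (g 1 1 : ℂ)) ^ (-((2 * ν + n : ℕ) : ℂ) / 2) * theta p (g • z)‖ ≤
        K ^ (ν + n / 2 : ℝ) * (Real.exp (-Real.pi * (1 / 4) * (t * z.im - 1)) * M) := by
    intro z hz
    obtain ⟨z', him, h2, hden⟩ := hg' z
    have hd := norm_pos_iff.2 (denominator_ne_zero g z)
    have hexp : (-((2 * ν + n : ℕ) : ℂ) / 2) = ((-(ν + n / 2) : ℝ) : ℂ) := by push_cast; ring
    have h3 : ‖((g 1 0 : ℂ) * (z : ℂ) + (g 1 1 : ℂ)) ^ (-((2 * ν + n : ℕ) : ℂ) / 2)‖ =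
        (‖denominator g z‖ ^ (ν + n / 2 : ℝ))⁻¹ := by
      rw [hexp, norm_cpow_real, Real.rpow_neg (norm_nonneg _)]; rfl
    have h4 := hfs z'
    simp only [← h2] at h4
    rw [norm_mul, h3, theta_eq_thetaSum, h4, hden, Real.mul_rpow hK.le hd.le,
      mul_comm (K ^ _), mul_assoc, inv_mul_cancel_left₀ (Real.rpow_pos_of_pos hd _).ne']
    refine mul_le_mul_of_nonneg_left ?_ (by positivity)
    have := hM z' (by rw [UpperHalfPlane.coe_im, him]; exact hz)
    rwa [UpperHalfPlane.coe_im, him] at this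
  have hlim : Filter.Tendsto (fun y : ℝ => K ^ (ν + n / 2 : ℝ) *
      (Real.exp (-Real.pi * (1 / 4) * (t * y - 1)) * M)) Filter.atTop (nhds 0) := by
    have h1 : Filter.Tendsto (fun y : ℝ => -Real.pi * (1 / 4) * (t * y - 1)) Filter.atTop
        Filter.atBot :=
      (Filter.tendsto_atTop_add_const_right _ (-1)
        (Filter.tendsto_id.const_mul_atTop ht)).const_mul_atTop_of_neg (by
          have := Real.pi_pos; linarith)
    simpa using ((Real.tendsto_exp_atBot.comp h1).mul_const M).const_mul (K ^ (ν + n / 2 : ℝ))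
  refine squeeze_zero_norm' ?_ (hlim.comp Filter.tendsto_comap)
  rw [Filter.Eventually, UpperHalfPlane.atImInfty_mem]
  refine ⟨1 / t, fun z hz => hbound z ?_⟩
  rw [div_le_iff₀ ht] at hz
  linarith

end

end ThetaHarmonic

theorem mainTheorem5 (n : ℕ) (hn : 2 ≤ n) (ν : ℕ) (p : MvPolynomial (Fin n) ℂ)
    (hhom : p.IsHomogeneous ν) (hharm : ThetaHarmonic.IsHarmonic p) :
    (∀ z : ℍ, Summable (ThetaHarmonic.thetaTerm p z)) ∧
    MDifferentiable 𝓘(ℂ) 𝓘(ℂ) (ThetaHarmonic.theta p) ∧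
    (∀ γ ∈ CongruenceSubgroup.Gamma0 4, ∀ z : ℍ,
      ThetaHarmonic.theta p (γ • z) =
        ThetaHarmonic.thetaMultiplier γ z ^ (2 * ν + n) * ThetaHarmonic.theta p z) ∧
    (0 < ν → ThetaHarmonic.IsCuspFormGamma0Four (2 * ν + n) (ThetaHarmonic.theta p)) := by
  have htrans := ThetaHarmonic.transform_of_generators (ThetaHarmonic.theta_T_smul p)
    (ThetaHarmonic.theta_lowerFour_smul hhom hharm)
  exact ⟨ThetaHarmonic.summable_thetaTerm p, ThetaHarmonic.mdifferentiable_theta p, htrans,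
    fun hν => ⟨ThetaHarmonic.mdifferentiable_theta p, htrans,
      ThetaHarmonic.isZeroAtImInfty_theta (by omega) hν hhom hharm⟩⟩
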